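/- Let $d\in\mathbf N$, $Q=[0,1]^d$, and let all functions on $\mathbf R^d$ be complex valued and identified when equal almost everywhere. A \emph{weight} on $\mathbf R^d$ is a positive function $\omega$ such that $\omega,1/\omega\in L^\infty_{loc}(\mathbf R^d)$. For weights $\omega,v$, $\omega$ is called \emph{$v$-moderate} if there is a constant $c>0$ such that $\omega(x+y)\le c\,\omega(x)v(y)$ for all $x,y\in\mathbf R^d$, and $\mathscr P_E(\mathbf R^d)$ denotes the set of all weights that are $v$-moderate for some weight $v$. For $p\in[1,\infty]$, $q\in(0,\infty]$ and $\omega\in\mathscr P_E(\mathbf R^d)$, the Wiener amalgam space $WL^{p,q}_{(\omega)}(\mathbf R^d)$ consists of all measurable functions $f$ such that $$ \|f\|_{WL^{p,q}_{(\omega)}}=\big\|\big(\|f\|_{L^p(k+Q)}\,\omega(k)\big)_{k\in\mathbf Z^d}\big\|_{\ell^q(\mathbf Z^d)}<\infty . $$ \textbf{Theorem.} Let $r\in(0,1]$, $p\in[1,\infty)$, $q\in[r,\infty)$, and let $\omega,v\in\mathscr P_E(\mathbf R^d)$ be such that $\omega$ is $v$-moderate. Then, for all $\phi\in WL^{1,r}_{(v)}(\mathbf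 R^d)$ and $g\in WL^{p,q}_{(\omega)}(\mathbf R^d)$, the integrals defining $\phi*g$ and $g*\phi$, where $(f*h)(x)=\int_{\mathbf R^d}f(t)h(x-t)\,dt$, converge absolutely for almost every $x$, and $$ WL^{1,r}_{(v)}(\mathbf R^d)*WL^{p,q}_{(\omega)}(\mathbf R^d) =WL^{p,q}_{(\omega)}(\mathbf R^d)*WL^{1,r}_{(v)}(\mathbf R^d) =WL^{p,q}_{(\omega)}(\mathbf R^d), $$ where $A*B=\{f*h : f\in A,\ h\in B\}$. -/

import Mathlib

open MeasureTheory
open scoped ENNReal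

namespace WienerAmalgam

/-- A weight on `ℝ^d` (modelled on `Fin d → ℝ` with Lebesgue measure): a positive function `ω`
such that `ω` and `1/ω` belong to `L^∞_loc`, i.e. are measurable and essentially bounded on
every compact set. -/
def IsWeight {d : ℕ} (ω : (Fin d → ℝ) → ℝ) : Prop :=
  (∀ x, 0 < ω x) ∧
    ∀ K : Set (Fin d → ℝ), IsCompact K →
      MemLp ω ∞ (volume.restrict K) ∧ MemLp (fun x => (ω x)⁻¹) ∞ (volume.restrict K)

/-- `ω` is `v`-moderate: `ω (x + y) ≤ c ω(x) v(y)` for all `x, y`, with a constant `c > 0`. -/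
def IsModerateWith {d : ℕ} (ω v : (Fin d → ℝ) → ℝ) : Prop :=
  ∃ c : ℝ, 0 < c ∧ ∀ x y, ω (x + y) ≤ c * (ω x * v y)

/-- The class `𝒫_E(ℝ^d)` of moderate weights: weights that are moderated by some weight. -/
def IsModerateWeight {d : ℕ} (ω : (Fin d → ℝ) → ℝ) : Prop :=
  IsWeight ω ∧ ∃ v : (Fin d → ℝ) → ℝ, IsWeight v ∧ IsModerateWith ω v

/-- The inclusion of `ℤ^d` into `ℝ^d`. -/
def latticePoint {d : ℕ} (k : Fin d → ℤ) : Fin d → ℝ := fun i => (k i : ℝ)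

/-- The cube `k + [0,1]^d`. -/
def unitCube {d : ℕ} (k : Fin d → ℤ) : Set (Fin d → ℝ) :=
  Set.Icc (latticePoint k) (latticePoint k + 1)

/-- The local norms `a_f(k) = ‖f‖_{L^p(k + [0,1]^d)}`, `k ∈ ℤ^d`. -/
noncomputable def localNorm {d : ℕ} (p : ℝ≥0∞) (f : (Fin d → ℝ) →ₘ[volume] ℂ)
    (k : Fin d → ℤ) : ℝ≥0∞ :=
  eLpNorm f p (volume.restrict (unitCube k))

/-- The Wiener amalgam quasi-norm `‖a_f ω‖_{ℓ^q(ℤ^d)}`, with values in `[0,∞]`. -/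
noncomputable def wienerNorm {d : ℕ} (p q : ℝ≥0∞) (ω : (Fin d → ℝ) → ℝ)
    (f : (Fin d → ℝ) →ₘ[volume] ℂ) : ℝ≥0∞ :=
  eLpNorm (fun k : Fin d → ℤ => localNorm p f k * ENNReal.ofReal (ω (latticePoint k)))
    q Measure.count

/-- The weighted Wiener amalgam space `WL^{p,q}_{(ω)}(ℝ^d)`: (classes modulo equality almost
everywhere of) measurable complex functions with finite Wiener amalgam quasi-norm. -/
def WL {d : ℕ} (p q : ℝ≥0∞) (ω : (Fin d → ℝ) → ℝ) : Set ((Fin d → ℝ) →ₘ[volume] ℂ) :=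
  {f | wienerNorm p q ω f < ∞}

theorem aestronglyMeasurable_convolution {d : ℕ} (f g : (Fin d → ℝ) →ₘ[volume] ℂ) :
    AEStronglyMeasurable
      (convolution (f : (Fin d → ℝ) → ℂ) g (ContinuousLinearMap.mul ℝ ℂ) volume) volume := by
  have h : StronglyMeasurable (fun z : (Fin d → ℝ) × (Fin d → ℝ) => f z.2 * g (z.1 - z.2)) :=
    (f.stronglyMeasurable.comp_measurable measurable_snd).mul
      (g.stronglyMeasurable.comp_measurable (measurable_fst.sub measurable_snd))
  exact (h.integral_prod_right (ν := volume)).aestronglyMeasurable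

/-- The convolution `(f * g)(x) = ∫ f(t) g(x - t) dt`. -/
noncomputable def conv {d : ℕ} (f g : (Fin d → ℝ) →ₘ[volume] ℂ) :
    (Fin d → ℝ) →ₘ[volume] ℂ :=
  AEEqFun.mk (convolution (f : (Fin d → ℝ) → ℂ) g (ContinuousLinearMap.mul ℝ ℂ) volume)
    (aestronglyMeasurable_convolution f g)

/-- The integral defining `f * g` converges absolutely at almost every point. -/
def ConvDefined {d : ℕ} (f g : (Fin d → ℝ) →ₘ[volume] ℂ) : Prop :=
  ∀ᵐ x, ConvolutionExistsAt (f : (Fin d → ℝ) → ℂ) g x (ContinuousLinearMap.mul ℝ ℂ) volume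

end WienerAmalgam

/-!
# Convolution factorization in Wiener amalgam spaces

For `r ≤ min (1, q)` the power `‖·‖ ^ r` of the quasi-norm of `WL^{p,q}_{(ω)}` is countably
subadditive (`amalgamNorm_tsum_rpow_le`), so that it turns the amalgam space into a complete normed
abelian group (`completeSpace_amalgamSpace`) whose norm is `r`-homogeneous. Only the values of the
weights on the lattice `ℤ^d` matter.

Absolute convergence of the convolutions and the inclusion of the product in `WL^{p,q}_{(ω)}` come
from cutting the first factor along the cubes `j + [0,1]^d`: Minkowski's inequality bounds the local
norms of a convolution by a discrete convolution of local norms (`eLpNorm_lconv_le`), and countable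
subadditivity together with the moderateness of `ω` gives
`‖φ * g‖ ^ r ≤ C ‖φ‖_{WL^{1,r}} ^ r ‖g‖_{WL^{p,q}} ^ r` (`amalgamNorm_lconv_le`).

For the factorization of `g`, the weight `v` is replaced by a submultiplicative one which dominates
it up to a constant (`submulHull`), for which `WL^{1,r}` is a convolution algebra acting on
`WL^{p,q}_{(ω)}`. The normalised indicator functions of the cubes `[0, 1/(n+1)]^d` are a bounded approximate unit
(`tendsto_rNorm_conv_approxUnit_sub`): translations are continuous in `L^p` on each cube as `p < ∞`,
and the contributions of the cubes are summed by dominated convergence as `q < ∞`. Cohen's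
factorization argument then applies (`exists_factorization_of_approximate_unit`). It is used in its
multiplicative form: with `S_n = β + (1 - β) e_n` for suitable members `e_n` of the approximate
unit, the products `S_1 ⋯ S_n = β ^ n + a_n` converge to an element `a` of the algebra, the elements
`h_n = S_n⁻¹ ⋯ S_1⁻¹ g` converge to some `h`, and `g = β ^ n h_n + a_n h_n` tends to `a h`.
-/

/-! ### Cohen factorization in `r`-normed modules -/

open Filter Topology in
/-- **Cohen factorization for `r`-normed modules.** If a complete algebra `A` acts on a complete
module `X`, both with `r`-homogeneous norms, and `A` has elements of bounded norm that act almost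
as the identity on any given `a : A` and `x : X`, then every element of `X` is of the form `a x`. -/
theorem exists_factorization_of_approximate_unit {A X : Type*}
    [NormedAddCommGroup A] [Module ℝ A] [CompleteSpace A]
    [NormedAddCommGroup X] [Module ℝ X] [CompleteSpace X] {r : ℝ} (hr : 0 < r)
    (hA : ∀ (c : ℝ) (a : A), ‖c • a‖ = |c| ^ r * ‖a‖)
    (hX : ∀ (c : ℝ) (x : X), ‖c • x‖ = |c| ^ r * ‖x‖)
    (mul : A →ₗ[ℝ] A →ₗ[ℝ] A) (act : A →ₗ[ℝ] X →ₗ[ℝ] X) {C B : ℝ}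
    (hact : ∀ a x, ‖act a x‖ ≤ C * ‖a‖ * ‖x‖)
    (hassoc : ∀ a b x, act (mul a b) x = act a (act b x))
    (hunit : ∀ (a : A) (x : X) (ε : ℝ), 0 < ε →
      ∃ e : A, ‖e‖ ≤ B ∧ ‖mul a e - a‖ < ε ∧ ‖act e x - x‖ < ε) (x : X) :
    ∃ a y, act a y = x := by
  obtain ⟨C', hC'0, hact'⟩ : ∃ C' : ℝ, 0 < C' ∧ ∀ a x, ‖act a x‖ ≤ C' * ‖a‖ * ‖x‖ :=
    ⟨|C| + 1, by positivity, fun a x => (hact a x).trans (by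
      gcongr; exact (le_abs_self C).trans (by linarith))⟩
  obtain ⟨B', hB'0, hunit'⟩ : ∃ B' : ℝ, 0 < B' ∧ ∀ (a : A) (x : X) (ε : ℝ), 0 < ε →
      ∃ e : A, ‖e‖ ≤ B' ∧ ‖mul a e - a‖ < ε ∧ ‖act e x - x‖ < ε :=
    ⟨|B| + 1, by positivity, fun a x ε hε => by
      obtain ⟨e, he, h⟩ := hunit a x ε hε
      exact ⟨e, he.trans ((le_abs_self B).trans (by linarith)), h⟩⟩
  -- `θ` is so small that `y ↦ θ • e y` is a `1/2`-contraction for every `e` of norm at most `B'`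
  obtain ⟨θ, hθ0, hθ⟩ : ∃ θ : ℝ, 0 < θ ∧ θ ^ r * (C' * B') ≤ 1 / 2 := by
    refine ⟨(1 / (2 * (C' * B'))) ^ (1 / r), by positivity, ?_⟩
    rw [← Real.rpow_mul (by positivity), one_div_mul_cancel hr.ne', Real.rpow_one]
    field_simp; rfl
  set β : ℝ := (1 + θ)⁻¹ with hβ
  have hβ0 : 0 < β := by positivity
  have hβ1 : β < 1 := inv_lt_one_of_one_lt₀ (by linarith)
  have hβi : β⁻¹ = 1 + θ := by rw [hβ, inv_inv]
  have hβθ : β * θ = 1 - β := by rw [hβ]; field_simp; ring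
  set ρ : ℝ := β ^ r with hρ
  have hρ0 : 0 < ρ := by positivity
  have hρ1 : ρ < 1 := Real.rpow_lt_one hβ0.le hβ1 hr
  -- One factor `β + (1 - β) e` is split off: the pair `(a, h)` stands for the representation
  -- `β ^ n h + a h` of `x`, which stays the same while both components move by `O(ρ ^ n)`.
  have step : ∀ (n : ℕ) (s : A × X), ∃ s' : A × X,
      ‖s'.1 - s.1‖ ≤ (1 + B') * ρ ^ n ∧ ‖s'.2 - s.2‖ ≤ 2 * θ ^ r * ρ ^ n ∧
      β ^ (n + 1) • s'.2 + act s'.1 s'.2 = β ^ n • s.2 + act s.1 s.2 := by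
    rintro n ⟨a, h⟩
    obtain ⟨e, heB, hea, heh⟩ := hunit' a h (ρ ^ n) (by positivity)
    -- the preimage of `h` under `β + (1 - β) e` is a fixed point of `Φ`
    let Φ : X → X := fun y => β⁻¹ • h - θ • act e y
    have hΦ : ContractingWith (1 / 2) Φ := by
      refine ⟨by rw [← NNReal.coe_lt_coe]; norm_num, LipschitzWith.of_dist_le_mul fun y z => ?_⟩
      have h1 : Φ y - Φ z = θ • act e (z - y) := by
        simp only [Φ, map_sub, smul_sub]; abel
      rw [dist_eq_norm, h1, hX, abs_of_pos hθ0, dist_comm, dist_eq_norm]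
      calc θ ^ r * ‖act e (z - y)‖ ≤ θ ^ r * (C' * B' * ‖z - y‖) := by
            gcongr
            exact (hact' _ _).trans (by gcongr)
        _ = θ ^ r * (C' * B') * ‖z - y‖ := by ring
        _ ≤ 1 / 2 * ‖z - y‖ := by gcongr
        _ = _ := by norm_num
    obtain ⟨h', hfix⟩ : ∃ h', Φ h' = h' := ⟨_, hΦ.fixedPoint_isFixedPt⟩
    have hd : ‖h' - h‖ ≤ 2 * θ ^ r * ρ ^ n := by
      have h1 := hΦ.dist_le_of_fixedPoint h hfix
      have h2 : h - Φ h = θ • (act e h - h) := by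
        simp only [Φ, hβi, add_smul, one_smul, smul_sub]; abel
      rw [dist_eq_norm h (Φ h), h2, hX, abs_of_pos hθ0, dist_comm, dist_eq_norm] at h1
      refine h1.trans ?_
      have : ((1 : ℝ) - ((1 / 2 : NNReal) : ℝ)) = 1 / 2 := by norm_num
      rw [this, div_div_eq_mul_div, div_one]
      have : θ ^ r * ‖act e h - h‖ ≤ θ ^ r * ρ ^ n := by gcongr
      linarith
    have hS : h = β • h' + (1 - β) • act e h' := by
      have : β • h' = β • (β⁻¹ • h - θ • act e h') := congrArg (β • ·) hfix.symm
      rw [this, smul_sub, smul_smul, smul_smul, hβθ, mul_inv_cancel₀ hβ0.ne', one_smul]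
      abel
    refine ⟨(β • a + (1 - β) • mul a e + (β ^ n * (1 - β)) • e, h'), ?_, hd, ?_⟩
    · have h1 : β • a + (1 - β) • mul a e + (β ^ n * (1 - β)) • e - a
          = (1 - β) • (mul a e - a) + (β ^ n * (1 - β)) • e := by
        simp only [smul_sub, sub_smul, one_smul]; abel
      simp only [h1]
      have hb1 : |1 - β| ^ r ≤ 1 := by
        rw [abs_of_pos (by linarith)]
        exact Real.rpow_le_one (by linarith) (by linarith) hr.le
      have hb2 : |β ^ n * (1 - β)| ^ r ≤ ρ ^ n := by
        rw [abs_mul, Real.mul_rpow (abs_nonneg _) (abs_nonneg _), abs_of_pos (by positivity)]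
        calc _ ≤ (β ^ n) ^ r * 1 := by gcongr
          _ = ρ ^ n := by
            rw [mul_one, hρ, ← Real.rpow_natCast, ← Real.rpow_natCast, ← Real.rpow_mul hβ0.le,
              ← Real.rpow_mul hβ0.le, mul_comm]
      calc _ ≤ _ := norm_add_le _ _
        _ ≤ 1 * ρ ^ n + ρ ^ n * B' := by
          rw [hA, hA]
          gcongr
        _ = _ := by ring
    · simp only [map_add, map_smul, LinearMap.add_apply, LinearMap.smul_apply, hassoc]
      conv_rhs => rw [hS]
      simp only [map_add, map_smul, smul_add, smul_smul, pow_succ]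
      abel
  choose f hf1 hf2 hf3 using step
  let s : ℕ → A × X := fun n => Nat.rec (0, x) f n
  have hs1 : ∀ n, ‖(s (n + 1)).1 - (s n).1‖ ≤ (1 + B') * ρ ^ n := fun n => hf1 n (s n)
  have hs2 : ∀ n, ‖(s (n + 1)).2 - (s n).2‖ ≤ 2 * θ ^ r * ρ ^ n := fun n => hf2 n (s n)
  have hs3 : ∀ n, β ^ n • (s n).2 + act (s n).1 (s n).2 = x := by
    intro n
    induction n with
    | zero => simp [s]
    | succ n ih => exact (hf3 n (s n)).trans ih
  obtain ⟨a, ha⟩ := cauchySeq_tendsto_of_complete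
    (cauchySeq_of_le_geometric (f := fun n => (s n).1) ρ (1 + B') hρ1
      (fun n => by rw [dist_comm, dist_eq_norm]; exact hs1 n))
  obtain ⟨y, hy⟩ := cauchySeq_tendsto_of_complete
    (cauchySeq_of_le_geometric (f := fun n => (s n).2) ρ (2 * θ ^ r) hρ1
      (fun n => by rw [dist_comm, dist_eq_norm]; exact hs2 n))
  refine ⟨a, y, ?_⟩
  have ha' : Tendsto (fun n => ‖(s n).1 - a‖) atTop (𝓝 0) := tendsto_iff_norm_sub_tendsto_zero.1 ha
  have hy' : Tendsto (fun n => ‖(s n).2 - y‖) atTop (𝓝 0) := tendsto_iff_norm_sub_tendsto_zero.1 hy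
  have h1 : Tendsto (fun n => ρ ^ n * ‖(s n).2‖ + C' * ‖(s n).1 - a‖ * ‖(s n).2‖
      + C' * ‖a‖ * ‖(s n).2 - y‖) atTop (𝓝 (0 * ‖y‖ + C' * 0 * ‖y‖ + C' * ‖a‖ * 0)) :=
    (((tendsto_pow_atTop_nhds_zero_of_lt_one hρ0.le hρ1).mul hy.norm).add
      ((ha'.const_mul C').mul hy.norm)).add (hy'.const_mul _)
  simp only [zero_mul, mul_zero, add_zero] at h1
  have h2 : ‖x - act a y‖ ≤ 0 := ge_of_tendsto' h1 fun n => by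
    have h3 : x - act a y = β ^ n • (s n).2 + act ((s n).1 - a) (s n).2
        + act a ((s n).2 - y) := by
      rw [← hs3 n]; simp only [map_sub, LinearMap.sub_apply]; abel
    rw [h3]
    refine (norm_add₃_le).trans ?_
    refine add_le_add (add_le_add (le_of_eq ?_) (hact' _ _)) (hact' _ _)
    rw [hX, abs_of_pos (by positivity), hρ, ← Real.rpow_natCast, ← Real.rpow_natCast,
      ← Real.rpow_mul hβ0.le, ← Real.rpow_mul hβ0.le, mul_comm r]
  exact (sub_eq_zero.1 (norm_le_zero_iff.1 h2)).symm

/-! ### Integral inequalities for functions with values in `[0,∞]` -/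

theorem ENNReal.rpow_tsum_le_tsum_rpow {ι : Type*} (u : ι → ℝ≥0∞) {r : ℝ} (hr0 : 0 < r)
    (hr1 : r ≤ 1) : (∑' i, u i) ^ r ≤ ∑' i, u i ^ r := by
  rw [ENNReal.tsum_eq_iSup_sum, show (⨆ s : Finset ι, ∑ i ∈ s, u i) ^ r =
    ⨆ s : Finset ι, (∑ i ∈ s, u i) ^ r from (ENNReal.orderIsoRpow r hr0).map_iSup _]
  refine iSup_le fun s => le_trans ?_ (ENNReal.sum_le_tsum s)
  exact Finset.le_sum_of_subadditive (fun a : ℝ≥0∞ => a ^ r) (by simp [hr0])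
    (fun a b => ENNReal.rpow_add_le_add_rpow a b hr0.le hr1) s u

theorem eLpNorm_tsum_le {α ι : Type*} [MeasurableSpace α] {μ : Measure α} [Countable ι]
    {f : ι → α → ℝ≥0∞} (hf : ∀ i, AEMeasurable (f i) μ) {p : ℝ≥0∞} (hp1 : 1 ≤ p) (hp : p ≠ ∞) :
    eLpNorm (fun x => ∑' i, f i x) p μ ≤ ∑' i, eLpNorm (f i) p μ := by
  have hp0 : p ≠ 0 := (zero_lt_one.trans_le hp1).ne'
  have ht : 0 < p.toReal := ENNReal.toReal_pos hp0 hp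
  rw [eLpNorm_eq_lintegral_rpow_enorm_toReal hp0 hp]
  have h1 : ∀ x, ‖∑' i, f i x‖ₑ ^ p.toReal = ⨆ s : Finset ι, (∑ i ∈ s, f i x) ^ p.toReal := by
    intro x
    rw [enorm_eq_self, ENNReal.tsum_eq_iSup_sum]
    exact (ENNReal.orderIsoRpow p.toReal ht).map_iSup _
  simp_rw [h1]
  rw [lintegral_iSup_directed]
  · rw [show ∀ g : Finset ι → ℝ≥0∞, (⨆ s, g s) ^ (1 / p.toReal) = ⨆ s, g s ^ (1 / p.toReal) from
      fun g => (ENNReal.orderIsoRpow (1 / p.toReal) (by positivity)).map_iSup _]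
    refine iSup_le fun s => le_trans ?_ (ENNReal.sum_le_tsum s)
    refine le_trans (le_of_eq ?_)
      (eLpNorm_sum_le (fun i _ => (hf i).aestronglyMeasurable) hp1)
    rw [eLpNorm_eq_lintegral_rpow_enorm_toReal hp0 hp]
    simp [Finset.sum_apply]
  · exact fun s => (Finset.aemeasurable_fun_sum s fun i _ => hf i).pow_const _
  · intro s t
    classical
    refine ⟨s ∪ t, fun x => ?_, fun x => ?_⟩
    · exact ENNReal.rpow_le_rpow (Finset.sum_le_sum_of_subset Finset.subset_union_left) ht.le
    · exact ENNReal.rpow_le_rpow (Finset.sum_le_sum_of_subset Finset.subset_union_right) ht.le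

/-- The power `‖·‖_q ^ r` of the `L^q` quasi-norm is countably subadditive for `r ≤ min (1, q)`,
because it is the `L^(q/r)` norm of the `r`-th power. -/
theorem eLpNorm_tsum_rpow_le {α ι : Type*} [MeasurableSpace α] {μ : Measure α} [Countable ι]
    {f : ι → α → ℝ≥0∞} (hf : ∀ i, AEMeasurable (f i) μ) {r q : ℝ≥0∞} (hr0 : 0 < r) (hr1 : r ≤ 1)
    (hrq : r ≤ q) (hq : q ≠ ∞) :
    eLpNorm (fun x => ∑' i, f i x) q μ ^ r.toReal ≤ ∑' i, eLpNorm (f i) q μ ^ r.toReal := by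
  have hr : r ≠ ∞ := ne_top_of_le_ne_top ENNReal.one_ne_top hr1
  have hr0' : 0 < r.toReal := ENNReal.toReal_pos hr0.ne' hr
  have key : ∀ g : α → ℝ≥0∞, eLpNorm g q μ ^ r.toReal
      = eLpNorm (fun x => g x ^ r.toReal) (q / r) μ := by
    intro g
    have h := eLpNorm_enorm_rpow (μ := μ) (p := q / r) g hr0'
    rw [ENNReal.ofReal_toReal hr, ENNReal.div_mul_cancel hr0.ne' hr] at h
    simpa using h.symm
  simp_rw [key]
  calc _ ≤ eLpNorm (fun x => ∑' i, f i x ^ r.toReal) (q / r) μ :=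
        eLpNorm_mono_enorm fun x => by
          simpa using ENNReal.rpow_tsum_le_tsum_rpow (fun i => f i x) hr0'
            (ENNReal.toReal_le_of_le_ofReal zero_le_one (by simpa using hr1))
    _ ≤ _ := eLpNorm_tsum_le (fun i => (hf i).pow_const _)
        ((ENNReal.le_div_iff_mul_le (Or.inl hr0.ne') (Or.inl hr)).2 (by simpa using hrq))
        (ENNReal.div_lt_top hq hr0.ne').ne

/-- Minkowski's integral inequality in the weak form where the slices are bounded uniformly. -/
theorem eLpNorm_lintegral_mul_le {α β : Type*} [MeasurableSpace α] [MeasurableSpace β]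
    {μ : Measure α} {ν : Measure β} [SFinite μ] [SFinite ν] {F : α → β → ℝ≥0∞}
    (hF : Measurable (Function.uncurry F)) {φ : β → ℝ≥0∞} (hφ : Measurable φ)
    {p : ℝ≥0∞} (hp1 : 1 ≤ p) (hp : p ≠ ∞) {M : ℝ≥0∞}
    (hM : ∀ᵐ t ∂ν, φ t ≠ 0 → eLpNorm (fun x => F x t) p μ ≤ M) :
    eLpNorm (fun x => ∫⁻ t, φ t * F x t ∂ν) p μ ≤ (∫⁻ t, φ t ∂ν) * M := by
  have hp0 : p ≠ 0 := (zero_lt_one.trans_le hp1).ne'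
  have ht : 0 < p.toReal := ENNReal.toReal_pos hp0 hp
  have ht1 : 1 ≤ p.toReal := by
    simpa using ENNReal.toReal_mono hp hp1
  set I := ∫⁻ t, φ t ∂ν with hI
  -- Jensen's inequality for the measure with density `φ`
  have hJ : ∀ x, (∫⁻ t, φ t * F x t ∂ν) ^ p.toReal
      ≤ I ^ (p.toReal - 1) * ∫⁻ t, φ t * F x t ^ p.toReal ∂ν := by
    intro x
    have hFx : Measurable (F x) := hF.of_uncurry_left
    have h := eLpNorm_le_eLpNorm_mul_rpow_measure_univ (μ := ν.withDensity φ) hp1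
      hFx.aestronglyMeasurable
    rw [eLpNorm_one_eq_lintegral_enorm, eLpNorm_eq_lintegral_rpow_enorm_toReal hp0 hp,
      withDensity_apply _ MeasurableSet.univ, Measure.restrict_univ] at h
    simp only [enorm_eq_self] at h
    rw [lintegral_withDensity_eq_lintegral_mul _ hφ hFx,
      lintegral_withDensity_eq_lintegral_mul _ hφ (hFx.pow_const _)] at h
    simp only [Pi.mul_apply, ENNReal.toReal_one, ← hI] at h
    refine (ENNReal.rpow_le_rpow h ht.le).trans (le_of_eq ?_)
    rw [ENNReal.mul_rpow_of_nonneg _ _ ht.le, ← ENNReal.rpow_mul, ← ENNReal.rpow_mul,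
      one_div_mul_cancel ht.ne', ENNReal.rpow_one, mul_comm]
    congr 2
    field_simp
  rw [eLpNorm_eq_lintegral_rpow_enorm_toReal hp0 hp]
  simp only [enorm_eq_self]
  calc (∫⁻ x, (∫⁻ t, φ t * F x t ∂ν) ^ p.toReal ∂μ) ^ (1 / p.toReal)
      ≤ (∫⁻ x, I ^ (p.toReal - 1) * ∫⁻ t, φ t * F x t ^ p.toReal ∂ν ∂μ) ^ (1 / p.toReal) := by
        gcongr with x; exact hJ x
    _ = (I ^ (p.toReal - 1) * ∫⁻ t, φ t * ∫⁻ x, F x t ^ p.toReal ∂μ ∂ν) ^ (1 / p.toReal) := by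
        have hm : Measurable (Function.uncurry fun x t => φ t * F x t ^ p.toReal) :=
          (hφ.comp measurable_snd).mul (hF.pow_const _)
        have hm' : Measurable fun x => ∫⁻ t, φ t * F x t ^ p.toReal ∂ν := hm.lintegral_prod_right'
        rw [lintegral_const_mul _ hm', lintegral_lintegral_swap hm.aemeasurable]
        congr 3
        ext t
        rw [lintegral_const_mul]
        exact (hF.comp (measurable_id.prodMk measurable_const)).pow_const _
    _ ≤ (I ^ (p.toReal - 1) * ∫⁻ t, φ t * M ^ p.toReal ∂ν) ^ (1 / p.toReal) := by
        gcongr ?_ ^ _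
        refine mul_le_mul' le_rfl ?_
        refine lintegral_mono_ae (hM.mono fun t h => ?_)
        by_cases h0 : φ t = 0
        · simp [h0]
        gcongr
        have := ENNReal.rpow_le_rpow (h h0) ht.le
        rwa [eLpNorm_eq_lintegral_rpow_enorm_toReal hp0 hp, ← ENNReal.rpow_mul,
          one_div_mul_cancel ht.ne', ENNReal.rpow_one] at this
    _ = (I ^ p.toReal * M ^ p.toReal) ^ (1 / p.toReal) := by
        rw [lintegral_mul_const _ hφ, ← hI, ← mul_assoc]
        congr 2
        conv_lhs => rw [← ENNReal.rpow_one I, ← ENNReal.rpow_mul, one_mul]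
        rw [← ENNReal.rpow_add_of_nonneg _ _ (by linarith) zero_le_one, sub_add_cancel]
    _ = I * M := by
        rw [← ENNReal.mul_rpow_of_nonneg _ _ ht.le, ← ENNReal.rpow_mul,
          mul_one_div_cancel ht.ne', ENNReal.rpow_one]

theorem eLpNorm_count {α : Type*} [MeasurableSpace α] [MeasurableSingletonClass α]
    (u : α → ℝ≥0∞) {q : ℝ≥0∞} (hq0 : q ≠ 0) (hq : q ≠ ∞) :
    eLpNorm u q Measure.count = (∑' k, u k ^ q.toReal) ^ (1 / q.toReal) := by
  rw [eLpNorm_eq_lintegral_rpow_enorm_toReal hq0 hq, lintegral_count]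
  simp

theorem eLpNorm_count_const_mul {α : Type*} [MeasurableSpace α] [MeasurableSingletonClass α]
    (c : ℝ≥0∞) (u : α → ℝ≥0∞) {q : ℝ≥0∞} (hq0 : q ≠ 0) (hq : q ≠ ∞) :
    eLpNorm (fun k => c * u k) q Measure.count = c * eLpNorm u q Measure.count := by
  have ht : 0 < q.toReal := ENNReal.toReal_pos hq0 hq
  rw [eLpNorm_count _ hq0 hq, eLpNorm_count _ hq0 hq]
  simp_rw [ENNReal.mul_rpow_of_nonneg _ _ ht.le]
  rw [ENNReal.tsum_mul_left, ENNReal.mul_rpow_of_nonneg _ _ (by positivity), ← ENNReal.rpow_mul,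
    mul_one_div_cancel ht.ne', ENNReal.rpow_one]

theorem eLpNorm_count_comp_equiv {α : Type*} [MeasurableSpace α] [MeasurableSingletonClass α]
    (σ : α ≃ α) (u : α → ℝ≥0∞) {q : ℝ≥0∞} (hq0 : q ≠ 0) (hq : q ≠ ∞) :
    eLpNorm (fun k => u (σ k)) q Measure.count = eLpNorm u q Measure.count := by
  rw [eLpNorm_count _ hq0 hq, eLpNorm_count _ hq0 hq]
  congr 1
  exact σ.tsum_eq fun k => u k ^ q.toReal

theorem le_eLpNorm_count {α : Type*} [MeasurableSpace α] [MeasurableSingletonClass α]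
    (u : α → ℝ≥0∞) {q : ℝ≥0∞} (hq0 : q ≠ 0) (hq : q ≠ ∞) (k : α) :
    u k ≤ eLpNorm u q Measure.count := by
  have ht : 0 < q.toReal := ENNReal.toReal_pos hq0 hq
  rw [eLpNorm_count _ hq0 hq]
  calc u k = (u k ^ q.toReal) ^ (1 / q.toReal) := by
        rw [← ENNReal.rpow_mul, mul_one_div_cancel ht.ne', ENNReal.rpow_one]
    _ ≤ _ := by gcongr; exact ENNReal.le_tsum k

namespace WienerAmalgam

variable {d : ℕ}

/-! ### The convolution inequality for amalgam quasi-norms -/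

/-- The convolution `∫ F(t) G(x - t) dt` of functions with values in `[0,∞]`. -/
noncomputable def lconv (F G : (Fin d → ℝ) → ℝ≥0∞) (x : Fin d → ℝ) : ℝ≥0∞ :=
  ∫⁻ t, F t * G (x - t)

theorem measurable_lconv {F G : (Fin d → ℝ) → ℝ≥0∞} (hF : Measurable F) (hG : Measurable G) :
    Measurable (lconv F G) :=
  Measurable.lintegral_prod_right' (f := fun z : (Fin d → ℝ) × (Fin d → ℝ) => F z.2 * G (z.1 - z.2))
    ((hF.comp measurable_snd).mul (hG.comp (measurable_fst.sub measurable_snd)))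

/-- The Wiener amalgam quasi-norm of a function with values in `[0,∞]`, with a weight `w` given on
the lattice only. -/
noncomputable def amalgamNorm (p q : ℝ≥0∞) (w : (Fin d → ℤ) → ℝ≥0∞) (F : (Fin d → ℝ) → ℝ≥0∞) :
    ℝ≥0∞ :=
  eLpNorm (fun k => eLpNorm F p (volume.restrict (unitCube k)) * w k) q Measure.count

theorem exists_mem_unitCube (x : Fin d → ℝ) : x ∈ unitCube fun i => ⌊x i⌋ := by
  refine ⟨fun i => Int.floor_le _, fun i => ?_⟩
  simpa [latticePoint] using (Int.lt_floor_add_one (x i)).le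

theorem iUnion_unitCube : ⋃ k : Fin d → ℤ, unitCube k = Set.univ :=
  Set.eq_univ_of_forall fun x => Set.mem_iUnion.2 ⟨_, exists_mem_unitCube x⟩

theorem measurableSet_unitCube (k : Fin d → ℤ) : MeasurableSet (unitCube k) := measurableSet_Icc

/-- The difference of two lattice cubes is covered by `2 ^ d` lattice cubes. -/
theorem exists_sub_mem_unitCube {k j : Fin d → ℤ} {x t : Fin d → ℝ} (hx : x ∈ unitCube k)
    (ht : t ∈ unitCube j) : ∃ e ∈ Finset.Icc (0 : Fin d → ℤ) 1, x - t ∈ unitCube (k - j - e) := by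
  classical
  refine ⟨fun i => if 0 ≤ x i - t i - (k i - j i) then 0 else 1, ?_, ?_, ?_⟩
  · rw [Finset.mem_Icc]
    constructor <;> intro i <;> by_cases h : 0 ≤ x i - t i - (k i - j i) <;> simp [h]
  all_goals
    intro i
    have h1 := hx.1 i
    have h2 := hx.2 i
    have h3 := ht.1 i
    have h4 := ht.2 i
    simp only [latticePoint, Pi.add_apply, Pi.one_apply, Pi.sub_apply] at h1 h2 h3 h4 ⊢
    split_ifs with h <;> push_cast <;> linarith

theorem ae_restrict_unitCube_iff {P : (Fin d → ℝ) → Prop} :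
    (∀ᵐ x, P x) ↔ ∀ k : Fin d → ℤ, ∀ᵐ x ∂volume.restrict (unitCube k), P x := by
  rw [← ae_restrict_iUnion_iff, iUnion_unitCube, Measure.restrict_univ]

/-- The norm over `k + [0,1]^d` of a translate by a vector of `j + [0,1]^d` is controlled by the
local norms on the cubes which cover the difference of these two cubes. -/
theorem eLpNorm_translate_le {ε : Type*} [TopologicalSpace ε] [ContinuousENorm ε] {p : ℝ≥0∞}
    (hp1 : 1 ≤ p) {G : (Fin d → ℝ) → ε} (hG : StronglyMeasurable G)
    {k j : Fin d → ℤ} {t : Fin d → ℝ} (ht : t ∈ unitCube j) :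
    eLpNorm (fun x => G (x - t)) p (volume.restrict (unitCube k))
      ≤ ∑ e ∈ Finset.Icc (0 : Fin d → ℤ) 1,
        eLpNorm G p (volume.restrict (unitCube (k - j - e))) := by
  have hGe : Measurable fun x => ‖G x‖ₑ := hG.enorm
  have h1 : ∀ (H : (Fin d → ℝ) → ε) (s : Set (Fin d → ℝ)), MeasurableSet s →
      eLpNorm H p (volume.restrict s) = eLpNorm (s.indicator fun x => ‖H x‖ₑ) p volume := by
    intro H s hs
    rw [eLpNorm_indicator_eq_eLpNorm_restrict hs, eLpNorm_enorm]
  rw [h1 _ _ (measurableSet_unitCube k)]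
  simp_rw [h1 G _ (measurableSet_unitCube _)]
  have hm : ∀ l : Fin d → ℤ, Measurable ((unitCube l).indicator fun x => ‖G x‖ₑ) := fun l =>
    hGe.indicator (measurableSet_unitCube l)
  calc _ ≤ eLpNorm (fun x => (∑ e ∈ Finset.Icc (0 : Fin d → ℤ) 1,
        (unitCube (k - j - e)).indicator fun x => ‖G x‖ₑ) (x - t)) p volume := by
        refine eLpNorm_mono_enorm fun x => ?_
        simp only [enorm_eq_self]
        by_cases hx : x ∈ unitCube k
        · obtain ⟨e, he, hxe⟩ := exists_sub_mem_unitCube hx ht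
          rw [Set.indicator_of_mem hx, Finset.sum_apply]
          refine le_trans (le_of_eq ?_) (Finset.single_le_sum (fun _ _ => zero_le) he)
          rw [Set.indicator_of_mem hxe]
        · simp [hx]
    _ = eLpNorm (∑ e ∈ Finset.Icc (0 : Fin d → ℤ) 1,
        (unitCube (k - j - e)).indicator fun x => ‖G x‖ₑ) p volume :=
        eLpNorm_comp_measurePreserving (Finset.aestronglyMeasurable_sum _
          fun e _ => (hm _).aestronglyMeasurable) (measurePreserving_sub_right volume t)
    _ ≤ _ := eLpNorm_sum_le (fun e _ => (hm _).aestronglyMeasurable) hp1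

/-- The local norms of a convolution are bounded by a discrete convolution of local norms. -/
theorem eLpNorm_lconv_le {p : ℝ≥0∞} (hp1 : 1 ≤ p) (hp : p ≠ ∞) {F G : (Fin d → ℝ) → ℝ≥0∞}
    (hF : Measurable F) (hG : Measurable G) (k : Fin d → ℤ) :
    eLpNorm (lconv F G) p (volume.restrict (unitCube k))
      ≤ ∑' j : Fin d → ℤ, (∫⁻ t in unitCube j, F t) * ∑ e ∈ Finset.Icc (0 : Fin d → ℤ) 1,
        eLpNorm G p (volume.restrict (unitCube (k - j - e))) := by
  have hm : Measurable (Function.uncurry fun x t : Fin d → ℝ => G (x - t)) :=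
    hG.comp (measurable_fst.sub measurable_snd)
  calc _ ≤ eLpNorm (fun x => ∑' j : Fin d → ℤ, ∫⁻ t in unitCube j, F t * G (x - t)) p
        (volume.restrict (unitCube k)) := by
        refine eLpNorm_mono_enorm fun x => ?_
        simp only [enorm_eq_self]
        rw [lconv, ← setLIntegral_univ, ← iUnion_unitCube]
        exact lintegral_iUnion_le _ _
    _ ≤ ∑' j : Fin d → ℤ, eLpNorm (fun x => ∫⁻ t in unitCube j, F t * G (x - t)) p
        (volume.restrict (unitCube k)) := by
        refine eLpNorm_tsum_le (fun j => ?_) hp1 hp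
        exact (Measurable.lintegral_prod_right' (ν := volume.restrict (unitCube j))
          (f := fun z : (Fin d → ℝ) × (Fin d → ℝ) => F z.2 * G (z.1 - z.2))
          ((hF.comp measurable_snd).mul hm)).aemeasurable
    _ ≤ _ := by
        refine ENNReal.tsum_le_tsum fun j => ?_
        refine eLpNorm_lintegral_mul_le hm hF hp1 hp ?_
        exact (ae_restrict_mem (measurableSet_unitCube j)).mono fun t ht _ =>
          eLpNorm_translate_le hp1 hG.stronglyMeasurable ht

theorem amalgamNorm_mono {p q : ℝ≥0∞} {w : (Fin d → ℤ) → ℝ≥0∞} {F G : (Fin d → ℝ) → ℝ≥0∞}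
    (h : ∀ᵐ x, F x ≤ G x) : amalgamNorm p q w F ≤ amalgamNorm p q w G := by
  refine eLpNorm_mono_enorm fun k => ?_
  simp only [enorm_eq_self]
  gcongr
  refine eLpNorm_mono_enorm_ae ?_
  simpa using ae_restrict_of_ae h

theorem amalgamNorm_tsum_rpow_le {ι : Type*} [Countable ι] {r p q : ℝ≥0∞} (hr0 : 0 < r)
    (hr1 : r ≤ 1) (hp1 : 1 ≤ p) (hp : p ≠ ∞) (hrq : r ≤ q) (hq : q ≠ ∞)
    (w : (Fin d → ℤ) → ℝ≥0∞) {F : ι → (Fin d → ℝ) → ℝ≥0∞} (hF : ∀ i, AEMeasurable (F i) volume) :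
    amalgamNorm p q w (fun x => ∑' i, F i x) ^ r.toReal
      ≤ ∑' i, amalgamNorm p q w (F i) ^ r.toReal := by
  refine le_trans ?_ (eLpNorm_tsum_rpow_le (fun i => (measurable_of_countable _).aemeasurable)
    hr0 hr1 hrq hq)
  refine ENNReal.rpow_le_rpow (eLpNorm_mono_enorm fun k => ?_) ENNReal.toReal_nonneg
  simp only [enorm_eq_self]
  rw [ENNReal.tsum_mul_right]
  gcongr
  exact eLpNorm_tsum_le (fun i => (hF i).restrict) hp1 hp

theorem amalgamNorm_one_rpow {r : ℝ≥0∞} (hr0 : 0 < r) (hr : r ≠ ∞) (v : (Fin d → ℤ) → ℝ≥0∞)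
    (F : (Fin d → ℝ) → ℝ≥0∞) :
    amalgamNorm 1 r v F ^ r.toReal = ∑' j, ((∫⁻ t in unitCube j, F t) * v j) ^ r.toReal := by
  have ht : 0 < r.toReal := ENNReal.toReal_pos hr0.ne' hr
  rw [amalgamNorm, eLpNorm_count _ hr0.ne' hr, ← ENNReal.rpow_mul, one_div_mul_cancel ht.ne',
    ENNReal.rpow_one]
  simp [eLpNorm_one_eq_lintegral_enorm]

/-- The convolution inequality `WL^{1,r}_{(v)} * WL^{p,q}_{(w)} ⊆ WL^{p,q}_{(w)}` with an explicit
constant. -/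
theorem amalgamNorm_lconv_le {r p q : ℝ≥0∞} (hr0 : 0 < r) (hr1 : r ≤ 1) (hp1 : 1 ≤ p)
    (hp : p ≠ ∞) (hrq : r ≤ q) (hq : q ≠ ∞) {w v : (Fin d → ℤ) → ℝ≥0∞} {K : ℝ≥0∞}
    (hmod : ∀ k j, ∀ e ∈ Finset.Icc (0 : Fin d → ℤ) 1, w (k + j + e) ≤ K * (w k * v j))
    {F G : (Fin d → ℝ) → ℝ≥0∞} (hF : Measurable F) (hG : Measurable G) :
    amalgamNorm p q w (lconv F G) ^ r.toReal
      ≤ (K ^ r.toReal * (Finset.Icc (0 : Fin d → ℤ) 1).card) * amalgamNorm 1 r v F ^ r.toReal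
        * amalgamNorm p q w G ^ r.toReal := by
  have hr : r ≠ ∞ := ne_top_of_le_ne_top ENNReal.one_ne_top hr1
  have hq0 : q ≠ 0 := (hr0.trans_le hrq).ne'
  -- `u (j, e)` is the contribution of the cube at `j` of `F` and of the shift by the vertex `e`
  let a : (Fin d → ℤ) → ℝ≥0∞ := fun j => ∫⁻ t in unitCube j, F t
  let b : (Fin d → ℤ) → ℝ≥0∞ := fun k => eLpNorm G p (volume.restrict (unitCube k))
  let E := Finset.Icc (0 : Fin d → ℤ) 1
  let u : (Fin d → ℤ) × E → (Fin d → ℤ) → ℝ≥0∞ := fun z k =>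
    (K * (a z.1 * v z.1)) * (b (k - z.1 - z.2) * w (k - z.1 - z.2))
  have hu : ∀ z, eLpNorm (u z) q Measure.count = K * (a z.1 * v z.1) * amalgamNorm p q w G := by
    intro z
    rw [eLpNorm_count_const_mul _ _ hq0 hq, amalgamNorm]
    congr 1
    refine Eq.trans ?_ (eLpNorm_count_comp_equiv (Equiv.subRight (z.1 + (z.2 : Fin d → ℤ)))
      (fun k => b k * w k) hq0 hq)
    simp [sub_sub]
  have h1 : amalgamNorm p q w (lconv F G) ≤ eLpNorm (fun k => ∑' z, u z k) q Measure.count := by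
    refine eLpNorm_mono_enorm fun k => ?_
    simp only [enorm_eq_self]
    calc _ ≤ (∑' j, a j * ∑ e ∈ E, b (k - j - e)) * w k := by
          gcongr; exact eLpNorm_lconv_le hp1 hp hF hG k
      _ = ∑' j, ∑' e : E, a j * b (k - j - e) * w k := by
          rw [← ENNReal.tsum_mul_right]
          refine tsum_congr fun j => ?_
          rw [← Finset.tsum_subtype E fun e => b (k - j - e), ← ENNReal.tsum_mul_left,
            ← ENNReal.tsum_mul_right]
      _ ≤ ∑' j, ∑' e : E, u (j, e) k := by
          refine ENNReal.tsum_le_tsum fun j => ENNReal.tsum_le_tsum fun e => ?_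
          have := hmod (k - j - e) j e e.2
          rw [show k - j - (e : Fin d → ℤ) + j + e = k by abel] at this
          calc _ ≤ a j * b (k - j - e) * (K * (w (k - j - e) * v j)) := by gcongr
            _ = _ := by simp only [u]; ring
      _ = _ := ENNReal.tsum_prod.symm
  calc _ ≤ eLpNorm (fun k => ∑' z, u z k) q Measure.count ^ r.toReal :=
        ENNReal.rpow_le_rpow h1 ENNReal.toReal_nonneg
    _ ≤ ∑' z, eLpNorm (u z) q Measure.count ^ r.toReal :=
        eLpNorm_tsum_rpow_le (fun i => (measurable_of_countable _).aemeasurable) hr0 hr1 hrq hq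
    _ = ∑' z : (Fin d → ℤ) × E, (K * (a z.1 * v z.1) * amalgamNorm p q w G) ^ r.toReal := by
        simp_rw [hu]
    _ = _ := by
        rw [ENNReal.tsum_prod']
        have hE : ∀ c : ℝ≥0∞, ∑' _ : E, c = E.card * c := fun c => by
          rw [tsum_fintype, Finset.sum_const, Finset.card_univ, Fintype.card_coe, nsmul_eq_mul]
        simp_rw [ENNReal.mul_rpow_of_nonneg _ _ (ENNReal.toReal_nonneg (a := r)), hE]
        rw [amalgamNorm_one_rpow hr0 hr, ← ENNReal.tsum_mul_left, ← ENNReal.tsum_mul_right]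
        refine tsum_congr fun j => ?_
        rw [ENNReal.mul_rpow_of_nonneg _ _ (ENNReal.toReal_nonneg (a := r))]
        simp only [a, E]
        ring

/-! ### The amalgam quasi-norm on classes of functions -/

/-- Exponents `r ≤ min (1, q)`, `1 ≤ p`, `p, q < ∞`, for which the `r`-th power of the quasi-norm
with exponents `p`, `q` is subadditive. -/
structure AdmissibleExponents (r p q : ℝ≥0∞) : Prop where
  r_pos : 0 < r
  r_le_one : r ≤ 1
  one_le_p : 1 ≤ p
  p_ne_top : p ≠ ∞
  r_le_q : r ≤ q
  q_ne_top : q ≠ ∞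

namespace AdmissibleExponents

variable {r p q : ℝ≥0∞} (H : AdmissibleExponents r p q)

include H

theorem r_ne_top : r ≠ ∞ := ne_top_of_le_ne_top ENNReal.one_ne_top H.r_le_one

theorem toReal_r_pos : 0 < r.toReal := ENNReal.toReal_pos H.r_pos.ne' H.r_ne_top

theorem q_ne_zero : q ≠ 0 := (H.r_pos.trans_le H.r_le_q).ne'

theorem toReal_q_pos : 0 < q.toReal := ENNReal.toReal_pos H.q_ne_zero H.q_ne_top

theorem p_ne_zero : p ≠ 0 := (zero_lt_one.trans_le H.one_le_p).ne'

theorem one : AdmissibleExponents r 1 r :=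
  ⟨H.r_pos, H.r_le_one, le_rfl, ENNReal.one_ne_top, le_rfl, H.r_ne_top⟩

end AdmissibleExponents

theorem eLpNorm_unitCube_lt_top {r p q : ℝ≥0∞} (H : AdmissibleExponents r p q)
    {w : (Fin d → ℤ) → ℝ≥0∞} {F : (Fin d → ℝ) → ℝ≥0∞} {k : Fin d → ℤ} (hw : w k ≠ 0)
    (h : amalgamNorm p q w F < ∞) : eLpNorm F p (volume.restrict (unitCube k)) < ∞ := by
  have h1 := (le_eLpNorm_count (fun k => eLpNorm F p (volume.restrict (unitCube k)) * w k)
    H.q_ne_zero H.q_ne_top k).trans_lt h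
  by_contra h2
  rw [not_lt, top_le_iff] at h2
  simp [h2, hw] at h1

theorem ae_lt_top_of_amalgamNorm_lt_top {r p q : ℝ≥0∞} (H : AdmissibleExponents r p q)
    {w : (Fin d → ℤ) → ℝ≥0∞} {F : (Fin d → ℝ) → ℝ≥0∞} (hw : ∀ k, w k ≠ 0) (hF : AEMeasurable F)
    (h : amalgamNorm p q w F < ∞) : ∀ᵐ x, F x < ∞ := by
  rw [ae_restrict_unitCube_iff]
  intro k
  have h1 := eLpNorm_unitCube_lt_top H (hw k) h
  have ht := ENNReal.toReal_pos H.p_ne_zero H.p_ne_top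
  rw [eLpNorm_eq_lintegral_rpow_enorm_toReal H.p_ne_zero H.p_ne_top,
    ENNReal.rpow_lt_top_iff_of_pos (by positivity)] at h1
  simp only [enorm_eq_self] at h1
  refine (ae_lt_top' (hF.restrict.pow_const _) h1.ne).mono fun x hx => ?_
  rwa [ENNReal.rpow_lt_top_iff_of_pos ht] at hx

/-- The `r`-th power of the Wiener amalgam quasi-norm. -/
noncomputable def rNorm (r p q : ℝ≥0∞) (w : (Fin d → ℤ) → ℝ≥0∞) (f : (Fin d → ℝ) →ₘ[volume] ℂ) :
    ℝ≥0∞ :=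
  amalgamNorm p q w (fun x => ‖f x‖ₑ) ^ r.toReal

theorem measurable_enorm_coe (f : (Fin d → ℝ) →ₘ[volume] ℂ) : Measurable fun x => ‖f x‖ₑ :=
  f.stronglyMeasurable.enorm

section

variable {r p q : ℝ≥0∞} (H : AdmissibleExponents r p q) {w : (Fin d → ℤ) → ℝ≥0∞}

include H

theorem rNorm_lt_top_iff {f : (Fin d → ℝ) →ₘ[volume] ℂ} :
    rNorm r p q w f < ∞ ↔ amalgamNorm p q w (fun x => ‖f x‖ₑ) < ∞ :=
  ENNReal.rpow_lt_top_iff_of_pos H.toReal_r_pos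

theorem rNorm_le_tsum {ι : Type*} [Countable ι] {f : (Fin d → ℝ) →ₘ[volume] ℂ}
    {g : ι → (Fin d → ℝ) →ₘ[volume] ℂ} (h : ∀ᵐ x, ‖f x‖ₑ ≤ ∑' i, ‖g i x‖ₑ) :
    rNorm r p q w f ≤ ∑' i, rNorm r p q w (g i) :=
  (ENNReal.rpow_le_rpow (amalgamNorm_mono h) ENNReal.toReal_nonneg).trans
    (amalgamNorm_tsum_rpow_le H.r_pos H.r_le_one H.one_le_p H.p_ne_top H.r_le_q H.q_ne_top w
      fun i => (measurable_enorm_coe (g i)).aemeasurable)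

theorem rNorm_smul (c : ℝ) (f : (Fin d → ℝ) →ₘ[volume] ℂ) :
    rNorm r p q w (c • f) = ‖c‖ₑ ^ r.toReal * rNorm r p q w f := by
  rw [rNorm, rNorm, ← ENNReal.mul_rpow_of_nonneg _ _ ENNReal.toReal_nonneg]
  congr 1
  rw [amalgamNorm, amalgamNorm, ← eLpNorm_count_const_mul _ _ H.q_ne_zero H.q_ne_top]
  congr 1
  ext k
  rw [← mul_assoc, eLpNorm_enorm, eLpNorm_enorm,
    eLpNorm_congr_ae (ae_restrict_of_ae (AEEqFun.coeFn_smul c f)), eLpNorm_const_smul]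

theorem rNorm_zero : rNorm r p q w (0 : (Fin d → ℝ) →ₘ[volume] ℂ) = 0 := by
  have h := rNorm_smul H (w := w) 0 (0 : (Fin d → ℝ) →ₘ[volume] ℂ)
  rwa [show (0 : ℝ) • (0 : (Fin d → ℝ) →ₘ[volume] ℂ) = 0 from
    zero_smul ℝ (0 : (Fin d → ℝ) →ₘ[volume] ℂ), enorm_zero,
    ENNReal.zero_rpow_of_pos H.toReal_r_pos, zero_mul] at h

theorem rNorm_neg (f : (Fin d → ℝ) →ₘ[volume] ℂ) : rNorm r p q w (-f) = rNorm r p q w f := by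
  have h := rNorm_smul H (w := w) (-1) f
  rwa [show (-1 : ℝ) • f = -f from neg_one_smul ℝ f, enorm_neg, enorm_one, ENNReal.one_rpow,
    one_mul] at h

theorem rNorm_add_le (f g : (Fin d → ℝ) →ₘ[volume] ℂ) :
    rNorm r p q w (f + g) ≤ rNorm r p q w f + rNorm r p q w g := by
  have := rNorm_le_tsum H (w := w) (f := f + g) (g := fun b : Bool => cond b f g) (by
    filter_upwards [AEEqFun.coeFn_add f g] with x hx
    rw [tsum_fintype, Fintype.sum_bool, hx]
    exact enorm_add_le _ _)
  rwa [tsum_fintype, Fintype.sum_bool] at this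

theorem eq_zero_of_rNorm_eq_zero (hw : ∀ k, w k ≠ 0) {f : (Fin d → ℝ) →ₘ[volume] ℂ}
    (h : rNorm r p q w f = 0) : f = 0 := by
  rw [rNorm, ENNReal.rpow_eq_zero_iff_of_pos H.toReal_r_pos] at h
  refine AEEqFun.ext (Filter.EventuallyEq.trans ?_ AEEqFun.coeFn_zero.symm)
  rw [Filter.EventuallyEq, ae_restrict_unitCube_iff]
  intro k
  have h1 := le_eLpNorm_count
    (fun k => eLpNorm (fun x => ‖f x‖ₑ) p (volume.restrict (unitCube k)) * w k)
    H.q_ne_zero H.q_ne_top k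
  rw [amalgamNorm] at h
  rw [h, nonpos_iff_eq_zero, mul_eq_zero, or_iff_left (hw k), eLpNorm_enorm,
    eLpNorm_eq_zero_iff f.stronglyMeasurable.aestronglyMeasurable H.p_ne_zero] at h1
  exact h1

/-- Completeness: a series whose terms have summable `rNorm` converges almost everywhere, and its
partial sums converge to the pointwise sum in `rNorm`. -/
theorem exists_tendsto_rNorm_sub_sum (hw : ∀ k, w k ≠ 0) {f : ℕ → (Fin d → ℝ) →ₘ[volume] ℂ}
    (h : ∑' n, rNorm r p q w (f n) ≠ ∞) :
    ∃ s, Filter.Tendsto (fun n => rNorm r p q w (s - ∑ i ∈ Finset.range n, f i)) Filter.atTop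
      (nhds 0) := by
  have hsum : ∀ᵐ x, Summable fun n => ‖f n x‖ := by
    have h1 : amalgamNorm p q w (fun x => ∑' n, ‖f n x‖ₑ) < ∞ := by
      rw [← ENNReal.rpow_lt_top_iff_of_pos H.toReal_r_pos]
      exact (amalgamNorm_tsum_rpow_le H.r_pos H.r_le_one H.one_le_p H.p_ne_top H.r_le_q
        H.q_ne_top w fun i => (measurable_enorm_coe (f i)).aemeasurable).trans_lt h.lt_top
    refine (ae_lt_top_of_amalgamNorm_lt_top H hw
      (Measurable.tsum fun n => measurable_enorm_coe (f n)).aemeasurable h1).mono fun x hx => ?_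
    exact tsum_enorm_ne_top_iff_summable_norm.1 hx.ne
  have hpart : ∀ n, ∀ᵐ x, (∑ i ∈ Finset.range n, f i : (Fin d → ℝ) →ₘ[volume] ℂ) x
      = ∑ i ∈ Finset.range n, f i x := by
    intro n
    induction n with
    | zero => exact AEEqFun.coeFn_zero
    | succ n ih =>
      simp_rw [Finset.sum_range_succ]
      filter_upwards [ih, AEEqFun.coeFn_add (∑ i ∈ Finset.range n, f i) (f n)] with x h1 h2
      rw [h2, Pi.add_apply, h1]
  have hs : AEStronglyMeasurable (fun x => ∑' n, f n x) (volume : Measure (Fin d → ℝ)) :=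
    aestronglyMeasurable_of_tendsto_ae (u := Filter.atTop)
      (f := fun n x => ∑ i ∈ Finset.range n, f i x)
      (fun n => Finset.aestronglyMeasurable_fun_sum _
        fun i _ => (f i).stronglyMeasurable.aestronglyMeasurable)
      (hsum.mono fun x hx => hx.of_norm.hasSum.tendsto_sum_nat)
  refine ⟨AEEqFun.mk _ hs, tendsto_of_tendsto_of_tendsto_of_le_of_le tendsto_const_nhds
    (ENNReal.tendsto_sum_nat_add _ h) (fun _ => zero_le) fun n => ?_⟩
  refine rNorm_le_tsum H ?_
  filter_upwards [hsum, hpart n, AEEqFun.coeFn_mk _ hs,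
    AEEqFun.coeFn_sub (AEEqFun.mk _ hs) (∑ i ∈ Finset.range n, f i)] with x h1 h2 h3 h4
  rw [h4, Pi.sub_apply, h3, h2, ← h1.of_norm.sum_add_tsum_nat_add n, add_sub_cancel_left]
  exact enorm_tsum_le_tsum_enorm

end

/-! ### Algebraic properties of the convolution -/

/-- `w` is moderate with respect to `v` on the lattice, with the constant `K`, up to shifts by the
vertices of the unit cube. -/
def LatticeModerate (K : ℝ≥0∞) (w v : (Fin d → ℤ) → ℝ≥0∞) : Prop :=
  ∀ k j, ∀ e ∈ Finset.Icc (0 : Fin d → ℤ) 1, w (k + j + e) ≤ K * (w k * v j)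

theorem coeFn_conv (f g : (Fin d → ℝ) →ₘ[volume] ℂ) :
    conv f g =ᵐ[volume] convolution (f : (Fin d → ℝ) → ℂ) g (ContinuousLinearMap.mul ℝ ℂ) volume :=
  AEEqFun.coeFn_mk _ _

theorem enorm_convolution_le (f g : (Fin d → ℝ) → ℂ) (x : Fin d → ℝ) :
    ‖convolution f g (ContinuousLinearMap.mul ℝ ℂ) volume x‖ₑ
      ≤ lconv (fun t => ‖f t‖ₑ) (fun t => ‖g t‖ₑ) x := by
  rw [convolution_def]
  refine (enorm_integral_le_lintegral_enorm _).trans (le_of_eq ?_)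
  simp [lconv, enorm_mul]

theorem enorm_conv_le (f g : (Fin d → ℝ) →ₘ[volume] ℂ) :
    ∀ᵐ x, ‖conv f g x‖ₑ ≤ lconv (fun t => ‖f t‖ₑ) (fun t => ‖g t‖ₑ) x := by
  filter_upwards [coeFn_conv f g] with x hx
  rw [hx]
  exact enorm_convolution_le _ _ _

theorem convolutionExistsAt_of_lconv_lt_top {f g : (Fin d → ℝ) → ℂ} (hf : StronglyMeasurable f)
    (hg : StronglyMeasurable g) {x : Fin d → ℝ}
    (h : lconv (fun t => ‖f t‖ₑ) (fun t => ‖g t‖ₑ) x < ∞) :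
    ConvolutionExistsAt f g x (ContinuousLinearMap.mul ℝ ℂ) volume := by
  refine ⟨?_, ?_⟩
  · exact (hf.mul (hg.comp_measurable (measurable_const.sub measurable_id))).aestronglyMeasurable
  · rw [hasFiniteIntegral_iff_enorm]
    simpa [lconv, enorm_mul] using h

theorem conv_comm (f g : (Fin d → ℝ) →ₘ[volume] ℂ) : conv f g = conv g f := by
  refine AEEqFun.ext ?_
  have h : convolution (f : (Fin d → ℝ) → ℂ) g (ContinuousLinearMap.mul ℝ ℂ) volume
      = convolution (g : (Fin d → ℝ) → ℂ) f (ContinuousLinearMap.mul ℝ ℂ) volume := by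
    rw [← convolution_flip, ContinuousLinearMap.flip_mul]
  filter_upwards [coeFn_conv f g, coeFn_conv g f] with x h1 h2
  rw [h1, h2, h]

theorem convDefined_comm {f g : (Fin d → ℝ) →ₘ[volume] ℂ} :
    ConvDefined f g ↔ ConvDefined g f := by
  refine Filter.eventually_congr (Filter.Eventually.of_forall fun x => ?_)
  rw [← convolutionExistsAt_flip, ContinuousLinearMap.flip_mul]

theorem conv_add {f g h : (Fin d → ℝ) →ₘ[volume] ℂ} (hg : ConvDefined f g)
    (hh : ConvDefined f h) : conv f (g + h) = conv f g + conv f h := by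
  refine AEEqFun.ext ?_
  have h0 : convolution (f : (Fin d → ℝ) → ℂ) ⇑(g + h) (ContinuousLinearMap.mul ℝ ℂ) volume
      = convolution (f : (Fin d → ℝ) → ℂ) (⇑g + ⇑h) (ContinuousLinearMap.mul ℝ ℂ) volume :=
    convolution_congr _ Filter.EventuallyEq.rfl (AEEqFun.coeFn_add g h)
  filter_upwards [coeFn_conv f g, coeFn_conv f h, coeFn_conv f (g + h), hg, hh,
    AEEqFun.coeFn_add (conv f g) (conv f h)] with x h1 h2 h3 h4 h5 h6
  rw [h3, h6, Pi.add_apply, h1, h2, h0, h4.distrib_add h5]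

theorem conv_smul (c : ℝ) (f g : (Fin d → ℝ) →ₘ[volume] ℂ) : conv f (c • g) = c • conv f g := by
  refine AEEqFun.ext ?_
  have h0 : convolution (f : (Fin d → ℝ) → ℂ) ⇑(c • g) (ContinuousLinearMap.mul ℝ ℂ) volume
      = convolution (f : (Fin d → ℝ) → ℂ) (c • ⇑g) (ContinuousLinearMap.mul ℝ ℂ) volume :=
    convolution_congr _ Filter.EventuallyEq.rfl (AEEqFun.coeFn_smul c g)
  filter_upwards [coeFn_conv f g, coeFn_conv f (c • g),
    AEEqFun.coeFn_smul c (conv f g)] with x h1 h2 h3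
  rw [h2, h3, Pi.smul_apply, h1, h0, convolution_smul, Pi.smul_apply]

theorem add_conv {f g h : (Fin d → ℝ) →ₘ[volume] ℂ} (hf : ConvDefined f h)
    (hg : ConvDefined g h) : conv (f + g) h = conv f h + conv g h := by
  rw [conv_comm, conv_add (convDefined_comm.1 hf) (convDefined_comm.1 hg), conv_comm h f,
    conv_comm h g]

theorem smul_conv (c : ℝ) (f g : (Fin d → ℝ) →ₘ[volume] ℂ) : conv (c • f) g = c • conv f g := by
  rw [conv_comm, conv_smul, conv_comm]

/-- Convolution is associative where the iterated convolution of the absolute values is finite. -/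
theorem conv_assoc {f g h : (Fin d → ℝ) →ₘ[volume] ℂ} (hfg : ConvDefined f g)
    (hgh : ∀ᵐ x, lconv (fun t => ‖g t‖ₑ) (fun t => ‖h t‖ₑ) x < ∞)
    (hfgh : ∀ᵐ x, lconv (fun t => ‖f t‖ₑ) (lconv (fun t => ‖g t‖ₑ) fun t => ‖h t‖ₑ) x < ∞) :
    conv (conv f g) h = conv f (conv g h) := by
  refine AEEqFun.ext ?_
  have h1 : convolution (conv f g) h (ContinuousLinearMap.mul ℝ ℂ) volume
      = convolution (convolution (f : (Fin d → ℝ) → ℂ) g (ContinuousLinearMap.mul ℝ ℂ) volume) h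
        (ContinuousLinearMap.mul ℝ ℂ) volume :=
    convolution_congr _ (coeFn_conv f g) Filter.EventuallyEq.rfl
  have h2 : convolution f (conv g h) (ContinuousLinearMap.mul ℝ ℂ) volume
      = convolution (f : (Fin d → ℝ) → ℂ)
        (convolution (g : (Fin d → ℝ) → ℂ) h (ContinuousLinearMap.mul ℝ ℂ) volume)
        (ContinuousLinearMap.mul ℝ ℂ) volume :=
    convolution_congr _ Filter.EventuallyEq.rfl (coeFn_conv g h)
  have hm : StronglyMeasurable (convolution (fun x => ‖g x‖) (fun x => ‖h x‖)
      (ContinuousLinearMap.mul ℝ ℝ) volume) := by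
    have : StronglyMeasurable fun z : (Fin d → ℝ) × (Fin d → ℝ) => ‖g z.2‖ * ‖h (z.1 - z.2)‖ :=
      (g.stronglyMeasurable.norm.comp_measurable measurable_snd).mul
        (h.stronglyMeasurable.norm.comp_measurable (measurable_fst.sub measurable_snd))
    exact this.integral_prod_right (ν := volume)
  filter_upwards [coeFn_conv (conv f g) h, coeFn_conv f (conv g h), hfgh] with x h3 h4 h5
  rw [h3, h4, h1, h2]
  refine convolution_assoc (ContinuousLinearMap.mul ℝ ℂ) (ContinuousLinearMap.mul ℝ ℂ)
    (ContinuousLinearMap.mul ℝ ℂ) (ContinuousLinearMap.mul ℝ ℂ) (fun a b c => ?_)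
    f.stronglyMeasurable.aestronglyMeasurable g.stronglyMeasurable.aestronglyMeasurable
    h.stronglyMeasurable.aestronglyMeasurable hfg (hgh.mono fun y hy => ?_) ⟨?_, ?_⟩
  · simp [mul_assoc]
  · refine ⟨?_, ?_⟩
    · exact (g.stronglyMeasurable.norm.mul (h.stronglyMeasurable.norm.comp_measurable
        (measurable_const.sub measurable_id))).aestronglyMeasurable
    · rw [hasFiniteIntegral_iff_enorm]
      simpa [lconv, enorm_mul] using hy
  · exact (f.stronglyMeasurable.norm.mul (hm.comp_measurable
      (measurable_const.sub measurable_id))).aestronglyMeasurable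
  · rw [hasFiniteIntegral_iff_enorm]
    refine lt_of_le_of_lt (lintegral_mono fun t => ?_) h5
    rw [ContinuousLinearMap.mul_apply', enorm_mul, enorm_norm]
    refine mul_le_mul' le_rfl ?_
    rw [convolution_def]
    refine (enorm_integral_le_lintegral_enorm _).trans (le_of_eq ?_)
    simp [lconv, enorm_mul]

section

variable {r p q : ℝ≥0∞} (H : AdmissibleExponents r p q) {K : ℝ≥0∞} (hK : K ≠ ∞)
  {w v : (Fin d → ℤ) → ℝ≥0∞} (hw : ∀ k, w k ≠ 0) (hwv : LatticeModerate K w v)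

include H hwv

theorem rNorm_conv_le (f g : (Fin d → ℝ) →ₘ[volume] ℂ) :
    rNorm r p q w (conv f g)
      ≤ (K ^ r.toReal * (Finset.Icc (0 : Fin d → ℤ) 1).card) * rNorm r 1 r v f
        * rNorm r p q w g :=
  (ENNReal.rpow_le_rpow (amalgamNorm_mono (enorm_conv_le f g)) ENNReal.toReal_nonneg).trans
    (amalgamNorm_lconv_le H.r_pos H.r_le_one H.one_le_p H.p_ne_top H.r_le_q H.q_ne_top hwv
      (measurable_enorm_coe f) (measurable_enorm_coe g))

include hK

theorem rNorm_conv_lt_top {f g : (Fin d → ℝ) →ₘ[volume] ℂ} (hf : rNorm r 1 r v f < ∞)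
    (hg : rNorm r p q w g < ∞) : rNorm r p q w (conv f g) < ∞ :=
  (rNorm_conv_le H hwv f g).trans_lt (ENNReal.mul_lt_top (ENNReal.mul_lt_top (ENNReal.mul_lt_top
    (ENNReal.rpow_lt_top_of_nonneg ENNReal.toReal_nonneg hK) (ENNReal.natCast_lt_top _)) hf) hg)

theorem amalgamNorm_lconv_lt_top {F G : (Fin d → ℝ) → ℝ≥0∞} (hF : Measurable F)
    (hG : Measurable G) (hF' : amalgamNorm 1 r v F < ∞) (hG' : amalgamNorm p q w G < ∞) :
    amalgamNorm p q w (lconv F G) < ∞ := by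
  rw [← ENNReal.rpow_lt_top_iff_of_pos H.toReal_r_pos] at hF' hG' ⊢
  exact (amalgamNorm_lconv_le H.r_pos H.r_le_one H.one_le_p H.p_ne_top H.r_le_q H.q_ne_top hwv
    hF hG).trans_lt (ENNReal.mul_lt_top (ENNReal.mul_lt_top (ENNReal.mul_lt_top
    (ENNReal.rpow_lt_top_of_nonneg ENNReal.toReal_nonneg hK) (ENNReal.natCast_lt_top _)) hF') hG')

include hw

/-- The convolution of the absolute values has a finite amalgam quasi-norm, hence is finite almost
everywhere. -/
theorem convDefined_of_rNorm_lt_top {f g : (Fin d → ℝ) →ₘ[volume] ℂ}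
    (hf : rNorm r 1 r v f < ∞) (hg : rNorm r p q w g < ∞) : ConvDefined f g := by
  rw [rNorm_lt_top_iff H] at hg
  rw [rNorm_lt_top_iff H.one] at hf
  exact (ae_lt_top_of_amalgamNorm_lt_top H hw
    (measurable_lconv (measurable_enorm_coe f) (measurable_enorm_coe g)).aemeasurable
    (amalgamNorm_lconv_lt_top H hK hwv (measurable_enorm_coe f) (measurable_enorm_coe g)
      hf hg)).mono fun x hx =>
    convolutionExistsAt_of_lconv_lt_top f.stronglyMeasurable g.stronglyMeasurable hx

theorem conv_assoc_of_rNorm_lt_top (hv : ∀ k, v k ≠ 0) (hvv : LatticeModerate K v v)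
    {f g h : (Fin d → ℝ) →ₘ[volume] ℂ} (hf : rNorm r 1 r v f < ∞) (hg : rNorm r 1 r v g < ∞)
    (hh : rNorm r p q w h < ∞) : conv (conv f g) h = conv f (conv g h) := by
  have hfg := convDefined_of_rNorm_lt_top H.one hK hv hvv hf hg
  rw [rNorm_lt_top_iff H] at hh
  rw [rNorm_lt_top_iff H.one] at hf hg
  have hm := measurable_lconv (measurable_enorm_coe g) (measurable_enorm_coe h)
  have h1 := amalgamNorm_lconv_lt_top H hK hwv (measurable_enorm_coe g) (measurable_enorm_coe h)
    hg hh
  have h2 := amalgamNorm_lconv_lt_top H hK hwv (measurable_enorm_coe f) hm hf h1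
  exact conv_assoc hfg (ae_lt_top_of_amalgamNorm_lt_top H hw hm.aemeasurable h1)
    (ae_lt_top_of_amalgamNorm_lt_top H hw
      (measurable_lconv (measurable_enorm_coe f) hm).aemeasurable h2)

end

/-! ### The approximate unit -/

/-- The normalised indicator function of the cube `[0, 1/(n+1)]^d`. -/
noncomputable def cubeKernel (d n : ℕ) : (Fin d → ℝ) → ℂ :=
  (Set.Icc (0 : Fin d → ℝ) fun _ => 1 / ((n : ℝ) + 1)).indicator fun _ => ((n : ℂ) + 1) ^ d

theorem stronglyMeasurable_cubeKernel (n : ℕ) : StronglyMeasurable (cubeKernel d n) :=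
  stronglyMeasurable_const.indicator measurableSet_Icc

theorem lintegral_cubeKernel (n : ℕ) : ∫⁻ t, ‖cubeKernel d n t‖ₑ = 1 := by
  simp only [cubeKernel, enorm_indicator_eq_indicator_enorm]
  rw [lintegral_indicator_const measurableSet_Icc, Real.volume_Icc_pi]
  simp only [Pi.zero_apply, sub_zero, Finset.prod_const, Finset.card_univ, Fintype.card_fin]
  have h : ‖((n : ℂ) + 1)‖ₑ = ENNReal.ofReal ((n : ℝ) + 1) := by
    rw [← ofReal_norm]
    congr 1
    rw [← Nat.cast_succ, Complex.norm_natCast, Nat.cast_succ]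
  rw [enorm_pow, h, ← mul_pow, ← ENNReal.ofReal_mul (by positivity),
    mul_one_div_cancel (by positivity), ENNReal.ofReal_one, one_pow]

theorem integral_cubeKernel (n : ℕ) : ∫ t, cubeKernel d n t = 1 := by
  rw [cubeKernel, integral_indicator measurableSet_Icc, setIntegral_const, measureReal_def,
    Real.volume_Icc_pi_toReal (fun _ => by simp; positivity)]
  simp only [Pi.zero_apply, sub_zero, Finset.prod_const, Finset.card_univ, Fintype.card_fin]
  rw [Complex.real_smul]
  push_cast
  rw [← mul_pow, one_div_mul_cancel (Nat.cast_add_one_ne_zero n), one_pow]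

theorem mem_unitCube_zero {n : ℕ} {t : Fin d → ℝ}
    (h : t ∈ Set.Icc (0 : Fin d → ℝ) fun _ => 1 / ((n : ℝ) + 1)) :
    t ∈ unitCube (0 : Fin d → ℤ) := by
  obtain ⟨h1, h2⟩ := h
  refine ⟨fun i => ?_, fun i => (h2 i).trans ?_⟩
  · simpa [latticePoint] using h1 i
  · simp only [latticePoint, Pi.add_apply, Pi.zero_apply, Int.cast_zero, Pi.one_apply, zero_add]
    rw [div_le_one (by positivity)]
    linarith [(Nat.cast_nonneg n : (0 : ℝ) ≤ n)]

theorem mem_Icc_of_cubeKernel_ne_zero {n : ℕ} {t : Fin d → ℝ} (h : cubeKernel d n t ≠ 0) :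
    t ∈ Set.Icc (0 : Fin d → ℝ) fun _ => 1 / ((n : ℝ) + 1) :=
  Set.mem_of_indicator_ne_zero h

/-- The class of `cubeKernel d n`; these classes form an approximate unit. -/
noncomputable def approxUnit (d n : ℕ) : (Fin d → ℝ) →ₘ[volume] ℂ :=
  AEEqFun.mk (cubeKernel d n) (stronglyMeasurable_cubeKernel n).aestronglyMeasurable

theorem rNorm_approxUnit_le {r : ℝ≥0∞} (hr0 : 0 < r) (hr : r ≠ ∞) (v : (Fin d → ℤ) → ℝ≥0∞)
    (n : ℕ) : rNorm r 1 r v (approxUnit d n)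
      ≤ ∑ j ∈ Finset.Icc (-1 : Fin d → ℤ) 1, v j ^ r.toReal := by
  have ht : 0 < r.toReal := ENNReal.toReal_pos hr0.ne' hr
  have hae : (fun t => ‖approxUnit d n t‖ₑ) =ᵐ[volume] fun t => ‖cubeKernel d n t‖ₑ :=
    (AEEqFun.coeFn_mk _ _).fun_comp _
  rw [rNorm, amalgamNorm_one_rpow hr0 hr]
  have h1 : ∀ j : Fin d → ℤ, ∫⁻ t in unitCube j, ‖approxUnit d n t‖ₑ ≤ 1 := fun j => by
    rw [lintegral_congr_ae (ae_restrict_of_ae hae)]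
    exact (setLIntegral_le_lintegral _ _).trans (lintegral_cubeKernel n).le
  have h0 : ∀ j ∉ Finset.Icc (-1 : Fin d → ℤ) 1, ∫⁻ t in unitCube j, ‖approxUnit d n t‖ₑ = 0 := by
    intro j hj
    rw [lintegral_congr_ae (ae_restrict_of_ae hae)]
    refine (setLIntegral_congr_fun (measurableSet_unitCube j) fun t ht' => ?_).trans lintegral_zero
    rw [enorm_eq_zero]
    by_contra h
    obtain ⟨h2, h3⟩ := mem_unitCube_zero (mem_Icc_of_cubeKernel_ne_zero h)
    refine hj (Finset.mem_Icc.2 ⟨fun i => ?_, fun i => ?_⟩)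
    · have h4 := ht'.2 i
      have h5 := h2 i
      simp only [latticePoint, Pi.add_apply, Pi.one_apply, Pi.zero_apply, Int.cast_zero] at h4 h5
      have : (-1 : ℝ) ≤ (j i : ℝ) := by linarith
      exact_mod_cast this
    · have h4 := ht'.1 i
      have h5 := h3 i
      simp only [latticePoint, Pi.add_apply, Pi.one_apply, Pi.zero_apply, Int.cast_zero] at h4 h5
      have : (j i : ℝ) ≤ (1 : ℝ) := by linarith
      exact_mod_cast this
  rw [tsum_eq_sum (s := Finset.Icc (-1 : Fin d → ℤ) 1) fun j hj => by
    rw [h0 j hj, zero_mul, ENNReal.zero_rpow_of_pos ht]]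
  gcongr with j
  exact (mul_le_mul' (h1 j) le_rfl).trans (one_mul _).le

/-- Translation is continuous in `L^p`. -/
theorem tendsto_eLpNorm_translate_sub {p : ℝ≥0∞} (hp1 : 1 ≤ p) (hp : p ≠ ∞) {f : (Fin d → ℝ) → ℂ}
    (hf : MemLp f p volume) :
    Filter.Tendsto (fun t => eLpNorm (fun x => f (x - t) - f x) p volume) (nhds 0) (nhds 0) := by
  have : Fact (1 ≤ p) := ⟨hp1⟩
  have hmp : ∀ t : Fin d → ℝ, MeasurePreserving (fun x => x - t) volume volume :=
    fun t => measurePreserving_sub_right volume t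
  let g : C(Fin d → ℝ, C(Fin d → ℝ, Fin d → ℝ)) :=
    (ContinuousMap.mk (fun z : (Fin d → ℝ) × (Fin d → ℝ) => z.2 - z.1)
      (continuous_snd.sub continuous_fst)).curry
  have h1 : Continuous fun t => Lp.compMeasurePreserving (g t) (hmp t) (hf.toLp f) :=
    continuous_const.compMeasurePreservingLp g.continuous hmp hp
  have h2 := h1.tendsto 0
  have h3 : ∀ t, Lp.compMeasurePreserving (g t) (hmp t) (hf.toLp f)
      = (hf.comp_measurePreserving (hmp t)).toLp _ := fun t => Lp.toLp_compMeasurePreserving _ _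
  simp_rw [h3] at h2
  rw [Lp.tendsto_Lp_iff_tendsto_eLpNorm''] at h2
  simpa [Function.comp_def, Pi.sub_def] using h2

/-- The modulus of continuity of `f` in `L^p(k + [0,1]^d)` with respect to translations by vectors
of `[0, 1/(n+1)]^d`. -/
noncomputable def localModulus (p : ℝ≥0∞) (f : (Fin d → ℝ) → ℂ) (n : ℕ) (k : Fin d → ℤ) : ℝ≥0∞ :=
  ⨆ t ∈ Set.Icc (0 : Fin d → ℝ) fun _ => 1 / ((n : ℝ) + 1),
    eLpNorm (fun x => f (x - t) - f x) p (volume.restrict (unitCube k))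

theorem localModulus_le {p : ℝ≥0∞} (hp1 : 1 ≤ p) {f : (Fin d → ℝ) → ℂ} (hf : StronglyMeasurable f)
    (n : ℕ) (k : Fin d → ℤ) :
    localModulus p f n k ≤ 2 * ∑ e ∈ Finset.Icc (0 : Fin d → ℤ) 1,
      eLpNorm f p (volume.restrict (unitCube (k - e))) := by
  refine iSup₂_le fun t ht => ?_
  rw [two_mul]
  refine (eLpNorm_sub_le (hf.comp_measurable (measurable_id.sub_const t)).aestronglyMeasurable
    hf.aestronglyMeasurable hp1).trans (add_le_add ?_ ?_)
  · have := eLpNorm_translate_le hp1 hf (k := k) (mem_unitCube_zero ht)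
    rwa [sub_zero] at this
  · have := Finset.single_le_sum (f := fun e : Fin d → ℤ =>
      eLpNorm f p (volume.restrict (unitCube (k - e)))) (fun _ _ => zero_le)
      (Finset.left_mem_Icc.2 (show (0 : Fin d → ℤ) ≤ 1 from fun _ => zero_le_one))
    simpa only [sub_zero] using this

theorem tendsto_localModulus {p : ℝ≥0∞} (hp1 : 1 ≤ p) (hp : p ≠ ∞) {f : (Fin d → ℝ) → ℂ}
    (hf : StronglyMeasurable f) (hfin : ∀ k, eLpNorm f p (volume.restrict (unitCube k)) < ∞)
    (k : Fin d → ℤ) :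
    Filter.Tendsto (fun n => localModulus p f n k) Filter.atTop (nhds 0) := by
  -- near `k + [0,1]^d` the function `f` agrees with its restriction to a finite union of cubes
  let s : Set (Fin d → ℝ) := ⋃ e ∈ Finset.Icc (0 : Fin d → ℤ) 1, unitCube (k - e)
  have hs : MeasurableSet s := Finset.measurableSet_biUnion _ fun e _ => measurableSet_unitCube _
  have hsub : ∀ x ∈ unitCube k, ∀ t ∈ unitCube (0 : Fin d → ℤ), x - t ∈ s := by
    intro x hx t ht
    obtain ⟨e, he, h⟩ := exists_sub_mem_unitCube hx ht
    rw [sub_zero] at h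
    exact Set.mem_biUnion he h
  have h0 : (0 : Fin d → ℝ) ∈ unitCube (0 : Fin d → ℤ) :=
    mem_unitCube_zero (n := 0) ⟨le_rfl, fun i => by simp⟩
  have hmem : MemLp (s.indicator f) p volume := by
    refine ⟨(hf.indicator hs).aestronglyMeasurable, ?_⟩
    have h1 : eLpNorm (s.indicator f) p volume
        ≤ eLpNorm (∑ e ∈ Finset.Icc (0 : Fin d → ℤ) 1,
          (unitCube (k - e)).indicator fun x => ‖f x‖ₑ) p volume := by
      refine eLpNorm_mono_enorm fun x => ?_
      rw [enorm_eq_self, Finset.sum_apply]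
      by_cases hx : x ∈ s
      · obtain ⟨e, he, hxe⟩ := Set.mem_iUnion₂.1 hx
        rw [Set.indicator_of_mem hx]
        refine le_trans (le_of_eq ?_) (Finset.single_le_sum (fun _ _ => zero_le) he)
        rw [Set.indicator_of_mem hxe]
      · simp [hx]
    refine h1.trans_lt ((eLpNorm_sum_le (fun e _ => (hf.enorm.indicator
      (measurableSet_unitCube _)).aestronglyMeasurable) hp1).trans_lt ?_)
    refine ENNReal.sum_lt_top.2 fun e _ => ?_
    rw [eLpNorm_indicator_eq_eLpNorm_restrict (measurableSet_unitCube _), eLpNorm_enorm]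
    exact hfin _
  rw [ENNReal.tendsto_nhds_zero]
  intro ε hε
  have h2 := (ENNReal.tendsto_nhds_zero.1 (tendsto_eLpNorm_translate_sub hp1 hp hmem)) ε hε
  obtain ⟨δ, hδ, hball⟩ := Metric.eventually_nhds_iff.1 h2
  have h3 := (tendsto_one_div_add_atTop_nhds_zero_nat (𝕜 := ℝ)).eventually (gt_mem_nhds hδ)
  filter_upwards [h3] with n hn
  refine iSup₂_le fun t ht => ?_
  have htd : dist t 0 < δ := by
    rw [dist_zero_right]
    refine lt_of_le_of_lt ((pi_norm_le_iff_of_nonneg (by positivity)).2 fun i => ?_) hn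
    rw [Real.norm_of_nonneg (ht.1 i)]
    exact ht.2 i
  refine le_trans ?_ (hball htd)
  refine le_trans (le_of_eq (eLpNorm_congr_ae ?_)) (eLpNorm_mono_measure _ Measure.restrict_le_self)
  filter_upwards [ae_restrict_mem (measurableSet_unitCube k)] with x hx
  rw [Set.indicator_of_mem (hsub x hx t (mem_unitCube_zero ht)),
    Set.indicator_of_mem (by simpa using hsub x hx 0 h0)]

/-- Averaging `f` over translations moves it by at most the local modulus of continuity. -/
theorem eLpNorm_conv_approxUnit_sub_le {p : ℝ≥0∞} (hp1 : 1 ≤ p) (hp : p ≠ ∞)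
    {f : (Fin d → ℝ) →ₘ[volume] ℂ} {n : ℕ} (hdef : ConvDefined (approxUnit d n) f)
    (k : Fin d → ℤ) :
    eLpNorm (fun x => ‖(conv (approxUnit d n) f - f : (Fin d → ℝ) →ₘ[volume] ℂ) x‖ₑ) p
      (volume.restrict (unitCube k)) ≤ localModulus p f n k := by
  have hae : approxUnit d n =ᵐ[volume] cubeKernel d n := AEEqFun.coeFn_mk _ _
  have hcongr := convolution_congr (ContinuousLinearMap.mul ℝ ℂ) hae
    (Filter.EventuallyEq.refl (ae volume) (f : (Fin d → ℝ) → ℂ))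
  have hint : Integrable (cubeKernel d n) volume :=
    ⟨(stronglyMeasurable_cubeKernel n).aestronglyMeasurable, by
      rw [hasFiniteIntegral_iff_enorm, lintegral_cubeKernel]; exact ENNReal.one_lt_top⟩
  have hpt : ∀ᵐ x, ‖(conv (approxUnit d n) f - f : (Fin d → ℝ) →ₘ[volume] ℂ) x‖ₑ
      ≤ ∫⁻ t, ‖cubeKernel d n t‖ₑ * ‖f (x - t) - f x‖ₑ := by
    filter_upwards [coeFn_conv (approxUnit d n) f, AEEqFun.coeFn_sub (conv (approxUnit d n) f) f,
      hdef] with x h1 h2 h3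
    have h4 : Integrable (fun t => cubeKernel d n t * f (x - t)) volume := by
      refine (integrable_congr ?_).1 h3
      filter_upwards [hae] with t ht
      rw [ht, ContinuousLinearMap.mul_apply']
    have h5 : conv (approxUnit d n) f x - f x
        = ∫ t, cubeKernel d n t * (f (x - t) - f x) := by
      simp_rw [mul_sub]
      rw [integral_sub h4 (hint.mul_const _), integral_mul_const, integral_cubeKernel, one_mul, h1,
        hcongr, convolution_def]
      rfl
    rw [h2, Pi.sub_apply, h5]
    refine (enorm_integral_le_lintegral_enorm _).trans (le_of_eq ?_)
    simp only [enorm_mul]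
  have hm : Measurable (Function.uncurry fun x t : Fin d → ℝ => ‖f (x - t) - f x‖ₑ) :=
    ((f.stronglyMeasurable.comp_measurable (measurable_fst.sub measurable_snd)).sub
      (f.stronglyMeasurable.comp_measurable measurable_fst)).enorm
  calc _ ≤ eLpNorm (fun x => ∫⁻ t, ‖cubeKernel d n t‖ₑ * ‖f (x - t) - f x‖ₑ) p
        (volume.restrict (unitCube k)) :=
        eLpNorm_mono_enorm_ae (by simpa only [enorm_eq_self] using ae_restrict_of_ae hpt)
    _ ≤ (∫⁻ t, ‖cubeKernel d n t‖ₑ) * localModulus p f n k := by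
        refine eLpNorm_lintegral_mul_le hm (stronglyMeasurable_cubeKernel n).enorm hp1 hp
          (Filter.Eventually.of_forall fun t ht => ?_)
        rw [eLpNorm_enorm]
        exact le_iSup₂_of_le t (mem_Icc_of_cubeKernel_ne_zero (by simpa using ht)) le_rfl
    _ = _ := by rw [lintegral_cubeKernel, one_mul]

/-- The kernels `approxUnit d n` form an approximate unit. -/
theorem tendsto_rNorm_conv_approxUnit_sub {r p q : ℝ≥0∞} (H : AdmissibleExponents r p q)
    {K : ℝ≥0∞} (hK : K ≠ ∞) {w v : (Fin d → ℤ) → ℝ≥0∞} (hw : ∀ k, w k ≠ 0) (hw' : ∀ k, w k ≠ ∞)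
    (hv' : ∀ k, v k ≠ ∞) (hwv : LatticeModerate K w v) {f : (Fin d → ℝ) →ₘ[volume] ℂ}
    (hf : rNorm r p q w f < ∞) :
    Filter.Tendsto (fun n => rNorm r p q w (conv (approxUnit d n) f - f)) Filter.atTop
      (nhds 0) := by
  have hq := H.toReal_q_pos
  have hr := H.toReal_r_pos
  have hunit : ∀ n, rNorm r 1 r v (approxUnit d n) < ∞ := fun n =>
    (rNorm_approxUnit_le H.r_pos H.r_ne_top v n).trans_lt (ENNReal.sum_lt_top.2 fun j _ =>
      ENNReal.rpow_lt_top_of_nonneg hr.le (hv' j))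
  let E := Finset.Icc (0 : Fin d → ℤ) 1
  let b : (Fin d → ℤ) → ℝ≥0∞ := fun k => eLpNorm (fun x => ‖f x‖ₑ) p (volume.restrict (unitCube k))
  have hfin : ∀ k, eLpNorm f p (volume.restrict (unitCube k)) < ∞ := fun k => by
    rw [← eLpNorm_enorm]
    exact eLpNorm_unitCube_lt_top H (hw k) ((rNorm_lt_top_iff H).1 hf)
  -- the dominating sequence
  let u : E → (Fin d → ℤ) → ℝ≥0∞ := fun e k => 2 * K * v 0 * (b (k - e) * w (k - e))
  have hdom : ∀ n k, localModulus p f n k * w k ≤ ∑' e, u e k := by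
    intro n k
    calc _ ≤ (2 * ∑ e ∈ E, b (k - e)) * w k := by
          gcongr
          simpa only [b, eLpNorm_enorm] using localModulus_le H.one_le_p f.stronglyMeasurable n k
      _ = ∑' e : E, 2 * b (k - e) * w k := by
          rw [← Finset.tsum_subtype E fun e => b (k - e), ← ENNReal.tsum_mul_left,
            ← ENNReal.tsum_mul_right]
      _ ≤ _ := by
          refine ENNReal.tsum_le_tsum fun e => ?_
          have h := hwv (k - e) 0 e e.2
          rw [add_zero, sub_add_cancel] at h
          calc _ ≤ 2 * b (k - e) * (K * (w (k - e) * v 0)) := by gcongr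
            _ = _ := by simp only [u]; ring
  have hu : eLpNorm (fun k => ∑' e, u e k) q Measure.count < ∞ := by
    rw [← ENNReal.rpow_lt_top_iff_of_pos hr]
    refine (eLpNorm_tsum_rpow_le (fun i => (measurable_of_countable _).aemeasurable) H.r_pos
      H.r_le_one H.r_le_q H.q_ne_top).trans_lt ?_
    rw [tsum_fintype]
    refine ENNReal.sum_lt_top.2 fun e _ => ENNReal.rpow_lt_top_of_nonneg hr.le (ne_of_lt ?_)
    rw [eLpNorm_count_const_mul _ _ H.q_ne_zero H.q_ne_top]
    refine ENNReal.mul_lt_top (ENNReal.mul_lt_top (ENNReal.mul_lt_top ENNReal.ofNat_lt_top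
      hK.lt_top) (hv' 0).lt_top) ?_
    refine lt_of_eq_of_lt ?_ ((rNorm_lt_top_iff H).1 hf)
    exact eLpNorm_count_comp_equiv (Equiv.subRight (e : Fin d → ℤ)) (fun k => b k * w k)
      H.q_ne_zero H.q_ne_top
  have hlim : Filter.Tendsto (fun n => eLpNorm (fun k => localModulus p f n k * w k) q
      Measure.count ^ r.toReal) Filter.atTop (nhds 0) := by
    have h1 : Filter.Tendsto (fun n => ∫⁻ k, (localModulus p f n k * w k) ^ q.toReal
        ∂Measure.count) Filter.atTop (nhds (∫⁻ _ : Fin d → ℤ, 0 ∂Measure.count)) := by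
      refine tendsto_lintegral_of_dominated_convergence (fun k => (∑' e, u e k) ^ q.toReal)
        (fun n => measurable_of_countable _)
        (fun n => Filter.Eventually.of_forall fun k => ENNReal.rpow_le_rpow (hdom n k) hq.le) ?_
        (Filter.Eventually.of_forall fun k => ?_)
      · rw [eLpNorm_count _ H.q_ne_zero H.q_ne_top,
          ENNReal.rpow_lt_top_iff_of_pos (by positivity)] at hu
        rw [lintegral_count]
        exact hu.ne
      · have h2 := ENNReal.Tendsto.mul_const (b := w k)
          (tendsto_localModulus H.one_le_p H.p_ne_top f.stronglyMeasurable hfin k)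
          (Or.inr (hw' k))
        have h3 := (ENNReal.continuous_rpow_const (y := q.toReal)).tendsto _ |>.comp h2
        simpa [ENNReal.zero_rpow_of_pos hq, Function.comp_def] using h3
    rw [lintegral_zero] at h1
    have h2 := ((ENNReal.continuous_rpow_const (y := 1 / q.toReal)).tendsto _).comp h1
    have h3 := ((ENNReal.continuous_rpow_const (y := r.toReal)).tendsto _).comp h2
    rw [ENNReal.zero_rpow_of_pos (by positivity), ENNReal.zero_rpow_of_pos hr] at h3
    refine h3.congr fun n => ?_
    simp only [Function.comp_apply]
    rw [eLpNorm_count _ H.q_ne_zero H.q_ne_top, lintegral_count]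
  refine tendsto_of_tendsto_of_tendsto_of_le_of_le tendsto_const_nhds hlim (fun _ => zero_le)
    fun n => ?_
  refine ENNReal.rpow_le_rpow (eLpNorm_mono_enorm fun k => ?_) hr.le
  simp only [enorm_eq_self]
  gcongr
  exact eLpNorm_conv_approxUnit_sub_le H.one_le_p H.p_ne_top
    (convDefined_of_rNorm_lt_top H hK hw hwv (hunit n) hf) k

/-! ### Factorization in amalgam spaces -/

/-- The amalgam space as a real vector space. The exponent `r` enters through the condition
`rNorm r p q w f < ∞` only, which does not depend on it. -/
def amalgamSpace {r p q : ℝ≥0∞} (H : AdmissibleExponents r p q) (w : (Fin d → ℤ) → ℝ≥0∞) :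
    Submodule ℝ ((Fin d → ℝ) →ₘ[volume] ℂ) where
  carrier := {f | rNorm r p q w f < ∞}
  add_mem' hf hg := (rNorm_add_le H _ _).trans_lt (ENNReal.add_lt_top.2 ⟨hf, hg⟩)
  zero_mem' := (rNorm_zero H).trans_lt ENNReal.zero_lt_top
  smul_mem' c f hf := (rNorm_smul H c f).trans_lt
    (ENNReal.mul_lt_top (ENNReal.rpow_lt_top_of_nonneg ENNReal.toReal_nonneg enorm_ne_top) hf)

/-- The amalgam space as a normed group, not a normed space, for the `r`-th power of the
Wiener amalgam quasi-norm. -/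
noncomputable abbrev amalgamSpaceNormedAddCommGroup {r p q : ℝ≥0∞} (H : AdmissibleExponents r p q)
    {w : (Fin d → ℤ) → ℝ≥0∞} (hw : ∀ k, w k ≠ 0) : NormedAddCommGroup (amalgamSpace H w) :=
  AddGroupNorm.toNormedAddCommGroup
    { toFun := fun f => (rNorm r p q w f.1).toReal
      map_zero' := by rw [ZeroMemClass.coe_zero, rNorm_zero H, ENNReal.toReal_zero]
      add_le' := fun f g => by
        rw [← ENNReal.toReal_add f.2.ne g.2.ne]
        exact ENNReal.toReal_mono (ENNReal.add_ne_top.2 ⟨f.2.ne, g.2.ne⟩) (rNorm_add_le H _ _)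
      neg' := fun f => by rw [NegMemClass.coe_neg, rNorm_neg H]
      eq_zero_of_map_eq_zero' := fun f hf => by
        rw [ENNReal.toReal_eq_zero_iff, or_iff_left f.2.ne] at hf
        exact Subtype.ext (eq_zero_of_rNorm_eq_zero H hw hf) }

theorem completeSpace_amalgamSpace {r p q : ℝ≥0∞} (H : AdmissibleExponents r p q)
    {w : (Fin d → ℤ) → ℝ≥0∞} (hw : ∀ k, w k ≠ 0) :
    letI := amalgamSpaceNormedAddCommGroup H hw
    CompleteSpace (amalgamSpace H w) := by
  let := amalgamSpaceNormedAddCommGroup H hw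
  refine NormedAddCommGroup.completeSpace_of_summable_imp_tendsto fun u hu => ?_
  have h1 : ∑' n, rNorm r p q w (u n).1 ≠ ∞ := by
    have h2 : ∀ n, rNorm r p q w (u n).1 = ENNReal.ofReal ‖u n‖ := fun n =>
      (ENNReal.ofReal_toReal (u n).2.ne).symm
    simp_rw [h2]
    exact hu.tsum_ofReal_ne_top
  obtain ⟨s, hs⟩ := exists_tendsto_rNorm_sub_sum H hw h1
  have hmem : s ∈ amalgamSpace H w := by
    obtain ⟨n, hn⟩ := (hs.eventually (gt_mem_nhds ENNReal.zero_lt_top)).exists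
    have h3 : s - ∑ i ∈ Finset.range n, (u i).1 ∈ amalgamSpace H w := hn
    have h4 := add_mem h3 (sum_mem fun i _ => (u i).2 : ∑ i ∈ Finset.range n, (u i).1 ∈ _)
    rwa [sub_add_cancel] at h4
  refine ⟨⟨s, hmem⟩, ?_⟩
  rw [tendsto_iff_norm_sub_tendsto_zero]
  have h5 := (ENNReal.tendsto_toReal ENNReal.zero_ne_top).comp hs
  rw [ENNReal.toReal_zero] at h5
  refine h5.congr fun n => ?_
  rw [norm_sub_rev]
  have h6 : s - ∑ i ∈ Finset.range n, (u i).1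
      = ((⟨s, hmem⟩ - ∑ i ∈ Finset.range n, u i : amalgamSpace H w) :
        (Fin d → ℝ) →ₘ[volume] ℂ) := by
    rw [AddSubgroupClass.coe_sub, AddSubmonoidClass.coe_finsetSum]
  simp only [Function.comp_apply, h6]
  rfl

/-- Convolution as a bilinear map on amalgam spaces. -/
noncomputable def convBilin {r p q : ℝ≥0∞} (H : AdmissibleExponents r p q) {K : ℝ≥0∞} (hK : K ≠ ∞)
    {w v : (Fin d → ℤ) → ℝ≥0∞} (hw : ∀ k, w k ≠ 0) (hwv : LatticeModerate K w v) :
    amalgamSpace H.one v →ₗ[ℝ] amalgamSpace H w →ₗ[ℝ] amalgamSpace H w :=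
  LinearMap.mk₂ ℝ (fun a x => ⟨conv a.1 x.1, rNorm_conv_lt_top H hK hwv a.2 x.2⟩)
    (fun a b x => Subtype.ext (add_conv (convDefined_of_rNorm_lt_top H hK hw hwv a.2 x.2)
      (convDefined_of_rNorm_lt_top H hK hw hwv b.2 x.2)))
    (fun c a x => Subtype.ext (smul_conv c a.1 x.1))
    (fun a x y => Subtype.ext (conv_add (convDefined_of_rNorm_lt_top H hK hw hwv a.2 x.2)
      (convDefined_of_rNorm_lt_top H hK hw hwv a.2 y.2)))
    (fun c a x => Subtype.ext (conv_smul c a.1 x.1))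

/-- Cohen factorization in amalgam spaces, for a weight `v` that is submultiplicative up to a
constant, so that `WL^{1,r}_{(v)}` is an algebra. -/
theorem exists_conv_eq {r p q : ℝ≥0∞} (H : AdmissibleExponents r p q) {K : ℝ≥0∞} (hK : K ≠ ∞)
    {w v : (Fin d → ℤ) → ℝ≥0∞} (hw : ∀ k, w k ≠ 0) (hw' : ∀ k, w k ≠ ∞) (hv : ∀ k, v k ≠ 0)
    (hv' : ∀ k, v k ≠ ∞) (hwv : LatticeModerate K w v) (hvv : LatticeModerate K v v)
    {g : (Fin d → ℝ) →ₘ[volume] ℂ} (hg : rNorm r p q w g < ∞) :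
    ∃ φ h, rNorm r 1 r v φ < ∞ ∧ rNorm r p q w h < ∞ ∧ conv φ h = g := by
  let := amalgamSpaceNormedAddCommGroup H hw
  let := amalgamSpaceNormedAddCommGroup H.one hv
  have := completeSpace_amalgamSpace H hw
  have := completeSpace_amalgamSpace H.one hv
  have hsmul : ∀ (c : ℝ) (b : ℝ≥0∞), (‖c‖ₑ ^ r.toReal * b).toReal = |c| ^ r.toReal * b.toReal := by
    intro c b
    rw [ENNReal.toReal_mul, ← ENNReal.toReal_rpow, toReal_enorm, Real.norm_eq_abs]
  have hBtop : ∑ j ∈ Finset.Icc (-1 : Fin d → ℤ) 1, v j ^ r.toReal < ∞ :=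
    ENNReal.sum_lt_top.2 fun j _ => ENNReal.rpow_lt_top_of_nonneg ENNReal.toReal_nonneg (hv' j)
  have hunit : ∀ n, rNorm r 1 r v (approxUnit d n) < ∞ := fun n =>
    (rNorm_approxUnit_le H.r_pos H.r_ne_top v n).trans_lt hBtop
  obtain ⟨φ, h, hφh⟩ := exists_factorization_of_approximate_unit (A := amalgamSpace H.one v)
    (X := amalgamSpace H w) H.toReal_r_pos
    (fun c a => (congrArg ENNReal.toReal (rNorm_smul H.one c a.1)).trans (hsmul c _))
    (fun c x => (congrArg ENNReal.toReal (rNorm_smul H c x.1)).trans (hsmul c _))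
    (convBilin H.one hK hv hvv) (convBilin H hK hw hwv)
    (C := (K ^ r.toReal * (Finset.Icc (0 : Fin d → ℤ) 1).card).toReal)
    (B := (∑ j ∈ Finset.Icc (-1 : Fin d → ℤ) 1, v j ^ r.toReal).toReal)
    (fun a x => by
      have h1 := ENNReal.toReal_mono (ENNReal.mul_lt_top (ENNReal.mul_lt_top (ENNReal.mul_lt_top
        (ENNReal.rpow_lt_top_of_nonneg ENNReal.toReal_nonneg hK) (ENNReal.natCast_lt_top _))
          a.2) x.2).ne (rNorm_conv_le H hwv a.1 x.1)
      rw [ENNReal.toReal_mul, ENNReal.toReal_mul] at h1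
      exact h1)
    (fun a b x => Subtype.ext
      (conv_assoc_of_rNorm_lt_top H hK hw hwv hv hvv a.2 b.2 x.2))
    (fun a x ε hε => by
      -- a kernel which is good for both `a` and `x`
      have h1 := tendsto_rNorm_conv_approxUnit_sub H.one hK hv hv' hv' hvv a.2
      have h2 := tendsto_rNorm_conv_approxUnit_sub H hK hw hw' hv' hwv x.2
      obtain ⟨n, hn1, hn2⟩ := ((h1.eventually (gt_mem_nhds (ENNReal.ofReal_pos.2 hε))).and
        (h2.eventually (gt_mem_nhds (ENNReal.ofReal_pos.2 hε)))).exists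
      refine ⟨⟨approxUnit d n, hunit n⟩,
        ENNReal.toReal_mono hBtop.ne (rNorm_approxUnit_le H.r_pos H.r_ne_top v n), ?_, ?_⟩
      · -- the approximate unit acts on `a` from the right here
        rw [conv_comm] at hn1
        exact (ENNReal.lt_ofReal_iff_toReal_lt hn1.ne_top).1 hn1
      · exact (ENNReal.lt_ofReal_iff_toReal_lt hn2.ne_top).1 hn2)
    ⟨g, hg⟩
  exact ⟨φ.1, h.1, φ.2, h.2, congrArg Subtype.val hφh⟩

/-! ### Weights on the lattice -/

/-- The restriction of a weight to the lattice. -/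
noncomputable def latticeWeight (ω : (Fin d → ℝ) → ℝ) (k : Fin d → ℤ) : ℝ≥0∞ :=
  ENNReal.ofReal (ω (latticePoint k))

theorem mem_WL_iff {r p q : ℝ≥0∞} (H : AdmissibleExponents r p q) {ω : (Fin d → ℝ) → ℝ}
    {f : (Fin d → ℝ) →ₘ[volume] ℂ} : f ∈ WL p q ω ↔ rNorm r p q (latticeWeight ω) f < ∞ := by
  rw [rNorm_lt_top_iff H]
  simp only [WL, wienerNorm, localNorm, amalgamNorm, latticeWeight, eLpNorm_enorm,
    Set.mem_ofPred_eq]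

theorem latticePoint_add (k l : Fin d → ℤ) :
    latticePoint (k + l) = latticePoint k + latticePoint l := by
  ext i; simp [latticePoint]

theorem IsModerateWith.exists_latticeWeight_le {ω v : (Fin d → ℝ) → ℝ} (h : IsModerateWith ω v)
    (hω : ∀ x, 0 < ω x) : ∃ C : ℝ≥0∞, C ≠ ∞ ∧ ∀ k l,
      latticeWeight ω (k + l) ≤ C * (latticeWeight ω k * latticeWeight v l) := by
  obtain ⟨c, hc, h⟩ := h
  refine ⟨ENNReal.ofReal c, ENNReal.ofReal_ne_top, fun k l => ?_⟩
  rw [latticeWeight, latticeWeight, latticeWeight, ← ENNReal.ofReal_mul (hω _).le,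
    ← ENNReal.ofReal_mul hc.le, latticePoint_add]
  exact ENNReal.ofReal_le_ofReal (h _ _)

/-- The smallest weight on the lattice with respect to which `v` is moderate with constant one. -/
noncomputable def submulHull (v : (Fin d → ℤ) → ℝ≥0∞) (l : Fin d → ℤ) : ℝ≥0∞ :=
  ⨆ k, v (k + l) / v k

section

variable {v : (Fin d → ℤ) → ℝ≥0∞} (hv : ∀ k, v k ≠ 0) (hv' : ∀ k, v k ≠ ∞)

include hv hv'

theorem le_mul_submulHull (k l : Fin d → ℤ) : v (k + l) ≤ v k * submulHull v l := by
  rw [mul_comm, ← ENNReal.div_le_iff (hv k) (hv' k)]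
  exact le_iSup (fun k => v (k + l) / v k) k

theorem submulHull_add_le (l m : Fin d → ℤ) :
    submulHull v (l + m) ≤ submulHull v l * submulHull v m := by
  refine iSup_le fun k => ?_
  rw [ENNReal.div_le_iff (hv k) (hv' k), ← add_assoc]
  calc _ ≤ v (k + l) * submulHull v m := le_mul_submulHull hv hv' _ _
    _ ≤ v k * submulHull v l * submulHull v m := by gcongr; exact le_mul_submulHull hv hv' _ _
    _ = _ := by ring

theorem submulHull_ne_zero (l : Fin d → ℤ) : submulHull v l ≠ 0 := fun h => by
  have := le_mul_submulHull hv hv' 0 l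
  rw [h, mul_zero, nonpos_iff_eq_zero] at this
  exact hv _ this

theorem submulHull_ne_top {u : (Fin d → ℤ) → ℝ≥0∞} (hu : ∀ k, u k ≠ ∞) {C : ℝ≥0∞} (hC : C ≠ ∞)
    (h : ∀ k l, v (k + l) ≤ C * (v k * u l)) (l : Fin d → ℤ) : submulHull v l ≠ ∞ := by
  refine ne_top_of_le_ne_top (ENNReal.mul_ne_top hC (hu l)) (iSup_le fun k => ?_)
  rw [ENNReal.div_le_iff (hv k) (hv' k)]
  exact (h k l).trans (le_of_eq (by ring))

end

end WienerAmalgam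

open WienerAmalgam in
theorem mainTheorem2 (d : ℕ) (r p q : ℝ≥0∞) (hr0 : 0 < r) (hr1 : r ≤ 1)
    (hp1 : 1 ≤ p) (hp : p < ∞) (hqr : r ≤ q) (hq : q < ∞)
    (ω v : (Fin d → ℝ) → ℝ)
    (hω : WienerAmalgam.IsModerateWeight ω) (hv : WienerAmalgam.IsModerateWeight v)
    (hωv : WienerAmalgam.IsModerateWith ω v) :
    (∀ φ ∈ WienerAmalgam.WL 1 r v, ∀ g ∈ WienerAmalgam.WL p q ω,
      WienerAmalgam.ConvDefined φ g ∧ WienerAmalgam.ConvDefined g φ) ∧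
    Set.image2 WienerAmalgam.conv (WienerAmalgam.WL 1 r v) (WienerAmalgam.WL p q ω) =
      WienerAmalgam.WL p q ω ∧
    Set.image2 WienerAmalgam.conv (WienerAmalgam.WL p q ω) (WienerAmalgam.WL 1 r v) =
      WienerAmalgam.WL p q ω := by
  have H : AdmissibleExponents r p q := ⟨hr0, hr1, hp1, hp.ne, hqr, hq.ne⟩
  obtain ⟨⟨hω0, -⟩, -⟩ := hω
  obtain ⟨⟨hv0, -⟩, v₁, -, hvv₁⟩ := hv
  have hpos : ∀ {u : (Fin d → ℝ) → ℝ}, (∀ x, 0 < u x) → ∀ k, latticeWeight u k ≠ 0 :=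
    fun hu k => (ENNReal.ofReal_pos.2 (hu _)).ne'
  have hfin : ∀ (u : (Fin d → ℝ) → ℝ) k, latticeWeight u k ≠ ∞ := fun u k => ENNReal.ofReal_ne_top
  obtain ⟨C, hC, hωC⟩ := hωv.exists_latticeWeight_le hω0
  obtain ⟨C₁, hC₁, hvC₁⟩ := hvv₁.exists_latticeWeight_le hv0
  set w := latticeWeight ω
  set u := latticeWeight v
  -- the kernels of the factorization are found in the smaller space with weight `V`
  set V := submulHull u
  have huV : ∀ k l, u (k + l) ≤ u k * V l := le_mul_submulHull (hpos hv0) (hfin v)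
  have hVV : ∀ k l, V (k + l) ≤ V k * V l := submulHull_add_le (hpos hv0) (hfin v)
  have hV' : ∀ k, V k ≠ ∞ := submulHull_ne_top (hpos hv0) (hfin v) (hfin v₁) hC₁ hvC₁
  have hV0 : ∀ k, V k ≠ 0 := submulHull_ne_zero (hpos hv0) (hfin v)
  let S := ∑ e ∈ Finset.Icc (0 : Fin d → ℤ) 1, V e
  have hS : S ≠ ∞ := (ENNReal.sum_lt_top.2 fun e _ => (hV' e).lt_top).ne
  have hVS : ∀ e ∈ Finset.Icc (0 : Fin d → ℤ) 1, V e ≤ S := fun e he =>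
    Finset.single_le_sum (fun _ _ => zero_le) he
  have hmod : LatticeModerate (C * S) w u := fun k j e he => by
    rw [add_assoc]
    calc _ ≤ C * (w k * u (j + e)) := hωC _ _
      _ ≤ C * (w k * (u j * S)) := by
        gcongr; exact (huV j e).trans (by gcongr; exact hVS e he)
      _ = _ := by ring
  have huV0 : ∀ j, u j ≤ u 0 * V j := fun j => by simpa using huV 0 j
  have hmod₁ : LatticeModerate (C * S * u 0 + S) w V := fun k j e he => by
    calc _ ≤ C * S * (w k * u j) := hmod k j e he
      _ ≤ C * S * (w k * (u 0 * V j)) := by gcongr; exact huV0 j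
      _ = C * S * u 0 * (w k * V j) := by ring
      _ ≤ _ := by gcongr; exact le_self_add
  have hmod₂ : LatticeModerate (C * S * u 0 + S) V V := fun k j e he => by
    calc _ ≤ V (k + j) * V e := hVV _ _
      _ ≤ V k * V j * S := by gcongr; exacts [hVV _ _, hVS e he]
      _ = S * (V k * V j) := by ring
      _ ≤ _ := by gcongr; exact le_add_self
  have hCS : C * S ≠ ∞ := ENNReal.mul_ne_top hC hS
  have hdef : ∀ φ ∈ WL 1 r v, ∀ g ∈ WL p q ω, ConvDefined φ g := fun φ hφ g hg =>
    convDefined_of_rNorm_lt_top H hCS (hpos hω0) hmod ((mem_WL_iff H.one).1 hφ)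
      ((mem_WL_iff H).1 hg)
  have himage : Set.image2 conv (WL 1 r v) (WL p q ω) = WL p q ω := by
    refine Set.Subset.antisymm ?_ fun g hg => ?_
    · rintro _ ⟨φ, hφ, g, hg, rfl⟩
      exact (mem_WL_iff H).2 (rNorm_conv_lt_top H hCS hmod ((mem_WL_iff H.one).1 hφ)
        ((mem_WL_iff H).1 hg))
    · obtain ⟨φ, h, hφ, hh, rfl⟩ := exists_conv_eq H
        (ENNReal.add_ne_top.2 ⟨ENNReal.mul_ne_top hCS (hfin v 0), hS⟩) (hpos hω0) (hfin ω) hV0 hV'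
        hmod₁ hmod₂ ((mem_WL_iff H).1 hg)
      refine ⟨φ, (mem_WL_iff H.one).2 ?_, h, (mem_WL_iff H).2 hh, rfl⟩
      rw [rNorm_lt_top_iff H.one] at hφ ⊢
      refine lt_of_le_of_lt (eLpNorm_mono_enorm fun k => ?_) ((eLpNorm_count_const_mul (u 0) _
        H.one.q_ne_zero H.one.q_ne_top).trans_lt (ENNReal.mul_lt_top (hfin v 0).lt_top hφ))
      simp only [enorm_eq_self]
      rw [mul_left_comm]
      gcongr
      exact huV0 k
  refine ⟨fun φ hφ g hg => ⟨hdef φ hφ g hg, convDefined_comm.1 (hdef φ hφ g hg)⟩, himage, ?_⟩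
  rw [Set.image2_swap]
  exact (Set.image2_congr' fun φ g => conv_comm g φ).trans himage
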